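/- **Setting.** Let $n\ge 1$ and let $\mathcal P_j=(A_j,B_j,C_j,D_j)$, $j\in\{1,\dots,\sigma\}$, be real state-space quadruples with $n$ states, $m$ inputs, $p$ outputs. Let $\varphi:\mathbb N\to\{1,\dots,\sigma\}$ be a switching sequence, write $(A(k),B(k),C(k),D(k))=\mathcal P_{\varphi(k)}$, and let $h(k,\ell)=C(k)A(k-1)\cdots A(\ell+1)B(\ell)$ for $k>\ell$, $h(k,k)=D(k)$, be the Markov parameters. Let $k_1<\dots<k_{i^*}$ be the switches in $[1,N]$ (the times $k\ge 2$ with $\varphi(k)\ne\varphi(k-1)$), $k_0=1$. The segments are $[k_i,k_{i+1})$ for $0\le i<i^*$ and $[k_{i^*},N]$; the dwell times are $\delta_i=k_{i+1}-k_i$ for $i<i^*$ and $\delta_{i^*}=N-k_{i^*}$. For a square matrix $X$ let $\mathcal M(X)$ be the sum of the moduli of its eigenvalues, counted with multiplicity. Assume: 1. every $\mathcal P_j$ is BIBO stable and has Macmillan degree $n$; 2. $\delta_i\ge n$ for $1\le i<i^*$; 3. for $k,l\in[1,N]$: $\mathcal M(A(k))\neq\mathcal M(A(l))\iff\varphi(k)\ne\varphi(l)$;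 4. for $k,l\in[1,N]$: $[C(k)\ D(k)]\ne[C(l)\ D(l)]\iff\varphi(k)\neq\varphi(l)$, and $\begin{bmatrix}B(k)\\D(k)\end{bmatrix}\ne\begin{bmatrix}B(l)\\D(l)\end{bmatrix}\iff\varphi(k)\neq\varphi(l)$. Call segment $i$ *long* if $\delta_0\ge 8n+1$ (when $i=0<i^*$), $\delta_i\ge 6n+1$ (when $0<i<i^*$), $\delta_{i^*}\ge 10n$ (when $i=i^*$). **Algorithm.** The data are noisy Markov parameters $\tilde h(k,\ell)=h(k,\ell)+e(k,\ell)$, $\|e(k,\ell)\|_F\le\varepsilon$, $1\le\ell\le k\le N$. Let $\tilde{\mathcal H}_{q,r}(k)$ be the block Hankel matrix with blocks $\tilde h(k+s,k-1-t)$, $0\le s<q$, $0\le t<r$, and $k'=2n+1$, $k''=N-4n$. The thresholds are $\varepsilon_{\mathbb Z},\tau,\varepsilon_c>0$. * *Intervals.* $\mathbb Z=\{k\in[k',k'']:\|\tilde{\mathcal H}_{2n+1,2n}(k+1)-\tilde{\mathcal H}_{2n+1,2n}(k)\|_F\le\varepsilon_{\mathbb Z}\}$. For a long segment $i$, $S_i=[\alpha_i,\beta_i]$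 is the largest interval of integers contained in $\mathbb Z$ and in segment $i$ whose ends satisfy $\alpha_i\le c_i$ and $\beta_i\ge d_i$, where $c_i=k_i+2n$ for $i>0$, $c_0=k'+2n$, $d_i=\min(k_{i+1}-2n-2,\,k'')$ for $i<i^*$ and $d_{i^*}=k''-2n-1$; and $\gamma_i=\lfloor(\alpha_i+\beta_i)/2\rfloor$. * *Discrete state estimates.* From the SVDs, truncated to the $n$ largest singular values (in decreasing order), $\tilde{\mathcal H}_{2n+1,2n}(k)\approx U(k)\Sigma(k)V(k)^T$ at $k=\gamma_i,\gamma_i+1$, put $\hat{\mathcal O}(k)=U(k)\Sigma(k)^{1/2}$, $\hat{\mathcal R}(k-1)=\Sigma(k)^{1/2}V(k)^T$. Then $\hat{\mathcal P}(\gamma_i)=(\hat A,\hat B,\hat C,\hat D)$ with $\hat A=(J_\downarrow\hat{\mathcal O}(\gamma_i+1))^\dagger J_\uparrow\hat{\mathcal O}(\gamma_i)$ ($J_\downarrow$, $J_\uparrow$ delete the last, respectively first, block row), $\hat C$ the first block row of $\hat{\mathcal O}(\gamma_i)$, $\hat B$ the first block column of $\hat{\mathcal R}(\gamma_i)$, $\hat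 D=\tilde h(\gamma_i,\gamma_i)$. * *Forward loop* ($i<i^*$). Starting at $\ell=\beta_i$, increase $\ell$ by one while $\|\check C-\hat C\|_F+\|\tilde h(\ell,\ell)-\hat D\|_F<\tau$, where $\check C=\tilde{\mathcal H}_{1,2n}(\ell)\,[\hat B\ \hat A\hat B\ \cdots\ \hat A^{2n-1}\hat B]^\dagger$. The final $\ell$ is the estimate of $k_{i+1}$. * *Backward loop* ($i>0$). Starting at $\ell=\alpha_i$, decrease $\ell$ by one while $\|\check B-\hat B\|_F+\|\tilde h(\ell,\ell)-\hat D\|_F<\tau$, where $\check B=[\hat C;\hat C\hat A;\dots;\hat C\hat A^{2n-1}]^\dagger\tilde{\mathcal H}_{2n,1}(\ell+1)$. The final $\ell$ plus $1$ is the estimate of $k_i$. (The start $1$ of the first and the end $N$ of the last segment are not detected; they are the ends of the record.) * *Output.* On the detected segment around $S_i$ the estimate $\hat\varphi$ is constant, its value being the cluster of $\mathcal M(\hat A(\gamma_i))$; two features are in the same cluster when they are joined by a chain of features of long segments with consecutive distances at most $\varepsilon_c$. **Theorem.** There is $\tau_0>0$ (depending on the system, $\varphi$ and $N$) such that for all thresholds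 $\varepsilon_{\mathbb Z},\tau,\varepsilon_c\in(0,\tau_0]$ there is $\varepsilon_0>0$ such that, for all noise of amplitude $\varepsilon\le\varepsilon_0$: * the intervals $S_i$ exist for all long segments, and if all segments are long, they are exactly the maximal intervals of $\mathbb Z$ with at least $2n$ points; * whenever the SVDs at $\gamma_i$ and $\gamma_i+1$ are computed consistently, in the sense that $\|U(\gamma_i+1)-U(\gamma_i)\|_F\le\varepsilon_0$ for all long segments, Algorithm 3′ recovers $\varphi$ on the long segments: for each long segment the detected end points are the true ones, and there is an injective relabelling $\pi$ of the discrete states such that $\hat\varphi(t)=\pi(\varphi(t))$ for every $t$ in a long segment. -/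

import Mathlib

open Matrix

noncomputable section

namespace SLS

/-- A discrete state `(A, B, C, D)` with `n` states, `m` inputs and `p` outputs. -/
structure DiscreteState (n m p : ℕ) where
  A : Matrix (Fin n) (Fin n) ℝ
  B : Matrix (Fin n) (Fin m) ℝ
  C : Matrix (Fin p) (Fin n) ℝ
  D : Matrix (Fin p) (Fin m) ℝ

/-- Frobenius norm. -/
def frob {ι κ : Type*} [Fintype ι] [Fintype κ] (M : Matrix ι κ ℝ) : ℝ :=
  Real.sqrt (∑ i, ∑ j, M i j ^ 2)

/-- `𝓜(X)`: the sum of the moduli of the complex eigenvalues of the real matrix `X`, counted with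
algebraic multiplicity. -/
def eigSum {n : ℕ} (X : Matrix (Fin n) (Fin n) ℝ) : ℝ :=
  ((X.map (algebraMap ℝ ℂ)).charpoly.roots.map (fun z : ℂ => ‖z‖)).sum

/-! ### The discrete states: stability and Macmillan degree -/

/-- Output at time `k` of the time-invariant system `P` started at rest at time `0`. -/
def DiscreteState.output {n m p : ℕ} (P : DiscreteState n m p) (u : ℕ → Fin m → ℝ) (k : ℕ) :
    Fin p → ℝ :=
  (∑ j ∈ Finset.range k, (P.C * P.A ^ (k - 1 - j) * P.B) *ᵥ u j) + P.D *ᵥ u k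

/-- Bounded inputs produce bounded outputs (from rest). -/
def DiscreteState.BIBOStable {n m p : ℕ} (P : DiscreteState n m p) : Prop :=
  ∀ u : ℕ → Fin m → ℝ, (∃ c : ℝ, ∀ k b, |u k b| ≤ c) →
    ∃ c : ℝ, ∀ k a, |P.output u k a| ≤ c

/-- The `r × r` block Hankel matrix `[C A^(s+t) B]` of the impulse response of `P`. -/
def DiscreteState.impulseHankel {n m p : ℕ} (P : DiscreteState n m p) (r : ℕ) :
    Matrix (Fin r × Fin p) (Fin r × Fin m) ℝ :=
  Matrix.of fun x y => (P.C * P.A ^ (x.1.val + y.1.val) * P.B) x.2 y.2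

/-- The Macmillan degree of (the transfer function of) `P` is `d`: the infinite block Hankel matrix
of the impulse response has rank `d`, that is, `d` is the largest rank of its finite sections. -/
def DiscreteState.HasMacmillanDegree {n m p : ℕ} (P : DiscreteState n m p) (d : ℕ) : Prop :=
  IsGreatest (Set.range fun r => (P.impulseHankel r).rank) d

/-! ### The switched linear system and its Markov parameters -/

/-- `transition A ℓ j = A(ℓ+j-1) ⋯ A(ℓ)`, the state transition matrix `Φ(ℓ + j, ℓ)`. -/
def transition {n : ℕ} (A : ℕ → Matrix (Fin n) (Fin n) ℝ) (ℓ : ℕ) :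
    ℕ → Matrix (Fin n) (Fin n) ℝ
  | 0 => 1
  | j + 1 => A (ℓ + j) * transition A ℓ j

/-- Doubly indexed Markov parameters `h(k, ℓ)` of the system with discrete states `mode` and
switching sequence `φ`. -/
def markov {n m p σ : ℕ} (mode : Fin σ → DiscreteState n m p) (φ : ℕ → Fin σ) (k ℓ : ℕ) :
    Matrix (Fin p) (Fin m) ℝ :=
  if ℓ < k then
    (mode (φ k)).C * transition (fun t => (mode (φ t)).A) (ℓ + 1) (k - (ℓ + 1)) * (mode (φ ℓ)).B
  else if ℓ = k then (mode (φ k)).D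
  else 0

/-- The segmentation of `[1, N]` by `φ`: the segments are `[κ i, κ (i+1))` for `0 ≤ i ≤ last`, where
`κ 0 = 1`, where `κ 1, …, κ last` are the switches, and where `κ (last + 1) = N + 1`. -/
structure IsSegmentation {σ : ℕ} (φ : ℕ → Fin σ) (N last : ℕ) (κ : ℕ → ℕ) : Prop where
  first_eq : κ 0 = 1
  end_eq : κ (last + 1) = N + 1
  lt_next : ∀ i ≤ last, κ i < κ (i + 1)
  const : ∀ i ≤ last, ∀ k, κ i ≤ k → k < κ (i + 1) → φ k = φ (κ i)
  switch : ∀ i < last, φ (κ (i + 1) - 1) ≠ φ (κ (i + 1))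

/-- Dwell times: `δ_i = κ (i+1) - κ i` for `i < last`, and `δ_last = N - κ last`. -/
def dwell (N last : ℕ) (κ : ℕ → ℕ) (i : ℕ) : ℕ :=
  if i = last then N - κ last else κ (i + 1) - κ i

/-- Every discrete state is BIBO stable and has Macmillan degree `n`. -/
def StableMinimal {n m p σ : ℕ} (mode : Fin σ → DiscreteState n m p) : Prop :=
  ∀ j, (mode j).BIBOStable ∧ (mode j).HasMacmillanDegree n

/-- The minimum dwell time is at least `n`. -/
def MinDwell (n N last : ℕ) (κ : ℕ → ℕ) : Prop :=
  ∀ i, 1 ≤ i → i < last → n ≤ dwell N last κ i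

/-- The feature `𝓜` separates the discrete states. -/
def Unimodal {n m p σ : ℕ} (mode : Fin σ → DiscreteState n m p) (φ : ℕ → Fin σ) (N : ℕ) : Prop :=
  ∀ k ∈ Set.Icc 1 N, ∀ l ∈ Set.Icc 1 N,
    (eigSum (mode (φ k)).A ≠ eigSum (mode (φ l)).A ↔ φ k ≠ φ l)

/-- Switch detectability from `[C D]` and from `[B; D]`. -/
def SwitchDetectable {n m p σ : ℕ} (mode : Fin σ → DiscreteState n m p) (φ : ℕ → Fin σ) (N : ℕ) :
    Prop :=
  ∀ k ∈ Set.Icc 1 N, ∀ l ∈ Set.Icc 1 N,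
    (Matrix.fromCols (mode (φ k)).C (mode (φ k)).D ≠
        Matrix.fromCols (mode (φ l)).C (mode (φ l)).D ↔ φ k ≠ φ l) ∧
    (Matrix.fromRows (mode (φ k)).B (mode (φ k)).D ≠
        Matrix.fromRows (mode (φ l)).B (mode (φ l)).D ↔ φ k ≠ φ l)

/-! ### Hankel matrices and the LTV realization algorithm -/

/-- Block Hankel matrix `𝓗_{q,r}(k)` filled with `h`; the block in position `(s, t)`, counted from
zero, is `h(k + s, k - 1 - t)`. It is used for `k > r` only. -/
def hankel {m p : ℕ} (h : ℕ → ℕ → Matrix (Fin p) (Fin m) ℝ) (q r k : ℕ) :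
    Matrix (Fin q × Fin p) (Fin r × Fin m) ℝ :=
  Matrix.of fun x y => h (k + x.1.val) (k - 1 - y.1.val) x.2 y.2

/-- First time `k' = 2n + 1` of the observation window. -/
def kFirst (n : ℕ) : ℕ := 2 * n + 1

/-- Last time `k'' = N - 4n` of the observation window. -/
def kLast (n N : ℕ) : ℕ := N - 4 * n

/-- `(X^T X)⁻¹ X^T` -/
def leftPinv {ι κ : Type*} [Fintype ι] [Fintype κ] [DecidableEq κ] (X : Matrix ι κ ℝ) :
    Matrix κ ι ℝ :=
  (Xᵀ * X)⁻¹ * Xᵀ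

/-- `X^T (X X^T)⁻¹` -/
def rightPinv {ι κ : Type*} [Fintype ι] [Fintype κ] [DecidableEq ι] (X : Matrix ι κ ℝ) :
    Matrix κ ι ℝ :=
  Xᵀ * (X * Xᵀ)⁻¹

/-- `(U, s, V)` is a singular value decomposition of `M` truncated to its `n` largest singular
values `s 0 ≥ s 1 ≥ ⋯`. The last field says that no singular value left out exceeds those kept. -/
structure IsTruncatedSVD {ι κ : Type*} [Fintype ι] [Fintype κ] {n : ℕ} (M : Matrix ι κ ℝ)
    (U : Matrix ι (Fin n) ℝ) (s : Fin n → ℝ) (V : Matrix κ (Fin n) ℝ) : Prop where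
  orth_left : Uᵀ * U = 1
  orth_right : Vᵀ * V = 1
  nonneg : ∀ j, 0 ≤ s j
  antitone : Antitone s
  mul_right : M * V = U * Matrix.diagonal s
  mul_left : Mᵀ * U = V * Matrix.diagonal s
  dominant : ∀ x : κ → ℝ, Vᵀ *ᵥ x = 0 → ∀ j, (M *ᵥ x) ⬝ᵥ (M *ᵥ x) ≤ s j ^ 2 * (x ⬝ᵥ x)

/-- Extended observability matrix estimate `U Σ^{1/2}`. -/
def obsEst {ι : Type*} {n : ℕ} (U : Matrix ι (Fin n) ℝ) (s : Fin n → ℝ) : Matrix ι (Fin n) ℝ :=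
  U * Matrix.diagonal fun j => Real.sqrt (s j)

/-- Extended controllability matrix estimate `Σ^{1/2} V^T`. -/
def ctrEst {κ : Type*} {n : ℕ} (s : Fin n → ℝ) (V : Matrix κ (Fin n) ℝ) : Matrix (Fin n) κ ℝ :=
  (Matrix.diagonal fun j => Real.sqrt (s j)) * Vᵀ

/-- `J_↑ X`: the first block row is removed. -/
def dropFirst {q p n : ℕ} (X : Matrix (Fin (q + 1) × Fin p) (Fin n) ℝ) :
    Matrix (Fin q × Fin p) (Fin n) ℝ :=
  X.submatrix (fun x => (x.1.succ, x.2)) id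

/-- `J_↓ X`: the last block row is removed. -/
def dropLast {q p n : ℕ} (X : Matrix (Fin (q + 1) × Fin p) (Fin n) ℝ) :
    Matrix (Fin q × Fin p) (Fin n) ℝ :=
  X.submatrix (fun x => (x.1.castSucc, x.2)) id

/-- `J_C = [I_p 0 ⋯ 0]` -/
def selC (q p : ℕ) : Matrix (Fin p) (Fin q × Fin p) ℝ :=
  Matrix.of fun a x => if x.1.val = 0 ∧ x.2 = a then 1 else 0

/-- `J_B`, the transpose of `[I_m 0 ⋯ 0]` -/
def selB (r m : ℕ) : Matrix (Fin r × Fin m) (Fin m) ℝ :=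
  Matrix.of fun x b => if x.1.val = 0 ∧ x.2 = b then 1 else 0

/-- The estimate of the state space matrices at time `k` from the Markov parameters `h` and from the
truncated singular value decompositions `U t, s t, V t` of the matrices `𝓗_{2n+1,2n}(t)`; those at
`t = k` and at `t = k + 1` are used. -/
def realize {n m p : ℕ} (h : ℕ → ℕ → Matrix (Fin p) (Fin m) ℝ)
    (U : ℕ → Matrix (Fin (2 * n + 1) × Fin p) (Fin n) ℝ) (s : ℕ → Fin n → ℝ)
    (V : ℕ → Matrix (Fin (2 * n) × Fin m) (Fin n) ℝ) (k : ℕ) : DiscreteState n m p where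
  A := leftPinv (dropLast (obsEst (U (k + 1)) (s (k + 1)))) * dropFirst (obsEst (U k) (s k))
  B := ctrEst (s (k + 1)) (V (k + 1)) * selB (2 * n) m
  C := selC (2 * n + 1) p * obsEst (U k) (s k)
  D := h k k

/-! ### The intervals on which the Hankel matrix does not change -/

/-- The times `k ∈ [k', k'']` with `‖𝓗(k+1) - 𝓗(k)‖_F ≤ εZ`. -/
def quietSet {m p : ℕ} (n N : ℕ) (h : ℕ → ℕ → Matrix (Fin p) (Fin m) ℝ) (εZ : ℝ) : Set ℕ :=
  {k | kFirst n ≤ k ∧ k ≤ kLast n N ∧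
    frob (hankel h (2 * n + 1) (2 * n) (k + 1) - hankel h (2 * n + 1) (2 * n) k) ≤ εZ}

/-- The segments on which the switching sequence is to be recovered. -/
def LongSegment (n N last : ℕ) (κ : ℕ → ℕ) (i : ℕ) : Prop :=
  (i = last ∧ 10 * n ≤ dwell N last κ i) ∨
  (i < last ∧ i = 0 ∧ 8 * n + 1 ≤ dwell N last κ i) ∨
  (i < last ∧ 0 < i ∧ 6 * n + 1 ≤ dwell N last κ i)

/-- Left end of the core of segment `i`. -/
def coreLeft (n : ℕ) (κ : ℕ → ℕ) (i : ℕ) : ℕ :=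
  if i = 0 then kFirst n + 2 * n else κ i + 2 * n

/-- Right end of the core of segment `i`. The minimum only matters when the switch `κ (i+1)` lies
beyond the observation window. -/
def coreRight (n N last : ℕ) (κ : ℕ → ℕ) (i : ℕ) : ℕ :=
  if i = last then kLast n N - 2 * n - 1 else min (κ (i + 1) - 2 * n - 2) (kLast n N)

/-- `S_i = [a, b]` is the largest interval of `Z` that lies in segment `i` and contains its core. -/
structure IsSegmentInterval (n N last : ℕ) (κ : ℕ → ℕ) (Z : Set ℕ) (i a b : ℕ) : Prop where
  left_le : a ≤ coreLeft n κ i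
  le_right : coreRight n N last κ i ≤ b
  le : a ≤ b
  subset : Set.Icc a b ⊆ Z ∩ Set.Ico (κ i) (κ (i + 1))
  maximal : ∀ a' b', a' ≤ coreLeft n κ i → coreRight n N last κ i ≤ b' →
    Set.Icc a' b' ⊆ Z ∩ Set.Ico (κ i) (κ (i + 1)) → Set.Icc a' b' ⊆ Set.Icc a b

/-- `[a, b]` is a maximal interval of integers inside `Z`. -/
def IsMaximalInterval (Z : Set ℕ) (a b : ℕ) : Prop :=
  a ≤ b ∧ Set.Icc a b ⊆ Z ∧
    ∀ a' b', a' ≤ a → b ≤ b' → Set.Icc a' b' ⊆ Z → a' = a ∧ b' = b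

/-! ### Switch detection from the Markov parameters -/

/-- Extended controllability matrix `[B, A B, …, A^(r-1) B]` of a discrete state. -/
def DiscreteState.ctr {n m p : ℕ} (P : DiscreteState n m p) (r : ℕ) :
    Matrix (Fin n) (Fin r × Fin m) ℝ :=
  Matrix.of fun i y => (P.A ^ y.1.val * P.B) i y.2

/-- Extended observability matrix `[C; C A; …; C A^(q-1)]` of a discrete state. -/
def DiscreteState.obs {n m p : ℕ} (P : DiscreteState n m p) (q : ℕ) :
    Matrix (Fin q × Fin p) (Fin n) ℝ :=
  Matrix.of fun x j => (P.C * P.A ^ x.1.val) x.2 j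

/-- `Č = 𝓗_{1,2n}(ℓ) 𝓡_{2n}^†`, with `𝓡_{2n}` formed from the estimate `P`. -/
def checkC {n m p : ℕ} (h : ℕ → ℕ → Matrix (Fin p) (Fin m) ℝ) (P : DiscreteState n m p) (ℓ : ℕ) :
    Matrix (Fin p) (Fin n) ℝ :=
  (hankel h 1 (2 * n) ℓ).submatrix (fun a => (0, a)) id * rightPinv (P.ctr (2 * n))

/-- `B̌ = 𝓞_{2n}^† 𝓗_{2n,1}(ℓ+1)`, with `𝓞_{2n}` formed from the estimate `P`. -/
def checkB {n m p : ℕ} (h : ℕ → ℕ → Matrix (Fin p) (Fin m) ℝ) (P : DiscreteState n m p) (ℓ : ℕ) :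
    Matrix (Fin n) (Fin m) ℝ :=
  leftPinv (P.obs (2 * n)) * (hankel h (2 * n) 1 (ℓ + 1)).submatrix id (fun b => (0, b))

/-- Forward criterion `‖Č - Ĉ‖_F + ‖Ď - D̂‖_F` at time `ℓ`. -/
def forwardCriterion {n m p : ℕ} (h : ℕ → ℕ → Matrix (Fin p) (Fin m) ℝ)
    (P : DiscreteState n m p) (ℓ : ℕ) : ℝ :=
  frob (checkC h P ℓ - P.C) + frob (h ℓ ℓ - P.D)

/-- Backward criterion `‖B̌ - B̂‖_F + ‖Ď - D̂‖_F` at time `ℓ`. -/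
def backwardCriterion {n m p : ℕ} (h : ℕ → ℕ → Matrix (Fin p) (Fin m) ℝ)
    (P : DiscreteState n m p) (ℓ : ℕ) : ℝ :=
  frob (checkB h P ℓ - P.B) + frob (h ℓ ℓ - P.D)

/-- Result of the forward loop: `ℓ` runs through `b, b+1, …` as long as the criterion stays below
the threshold `τ` (and at most until the record is exhausted). -/
def nextSwitch {n m p : ℕ} (h : ℕ → ℕ → Matrix (Fin p) (Fin m) ℝ) (P : DiscreteState n m p)
    (N : ℕ) (τ : ℝ) (b : ℕ) : ℕ :=
  sInf {ℓ | b ≤ ℓ ∧ (τ ≤ forwardCriterion h P ℓ ∨ N < ℓ)}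

/-- Result of the backward loop: `ℓ` runs through `a, a-1, …` as long as the criterion stays below
the threshold `τ` (and at most until the record is exhausted); the switch is at the last `ℓ`,
plus `1`. -/
def prevSwitch {n m p : ℕ} (h : ℕ → ℕ → Matrix (Fin p) (Fin m) ℝ) (P : DiscreteState n m p)
    (τ : ℝ) (a : ℕ) : ℕ :=
  sSup {ℓ | ℓ ≤ a ∧ (τ ≤ backwardCriterion h P ℓ ∨ ℓ = 0)} + 1

/-- Midpoint of `[a, b]`, rounded down. -/
def midpoint (a b : ℕ) : ℕ := (a + b) / 2

/-- The algorithm's left end of the segment around `S_i = [a, b]`. -/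
def segLeft {n m p : ℕ} (h : ℕ → ℕ → Matrix (Fin p) (Fin m) ℝ) (P : DiscreteState n m p)
    (τ : ℝ) (i a : ℕ) : ℕ :=
  if i = 0 then 1 else prevSwitch h P τ a

/-- The algorithm's right end (excluded) of the segment around `S_i = [a, b]`. -/
def segRight {n m p : ℕ} (h : ℕ → ℕ → Matrix (Fin p) (Fin m) ℝ) (P : DiscreteState n m p)
    (N last : ℕ) (τ : ℝ) (i b : ℕ) : ℕ :=
  if i = last then N + 1 else nextSwitch h P N τ b

/-- Indices `i, j` in `I` lie in the same cluster: they are joined by a chain of indices in `I` whose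
consecutive features `𝓜(Â)` differ by at most `εc`. -/
def SameCluster {n m p : ℕ} (I : Set ℕ) (P : ℕ → DiscreteState n m p) (εc : ℝ) (i j : ℕ) : Prop :=
  Relation.ReflTransGen
    (fun i j => i ∈ I ∧ j ∈ I ∧ |eigSum (P i).A - eigSum (P j).A| ≤ εc) i j

/-- The estimated switching sequence: at time `t` its value is the cluster (a set of indices) of the
discrete state estimate `P i` whose detected segment `[lo i, hi i)`, `i ∈ I`, contains `t`. -/
def estimatedSwitching {n m p : ℕ} (I : Set ℕ) (P : ℕ → DiscreteState n m p) (εc : ℝ)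
    (lo hi : ℕ → ℕ) (t : ℕ) : Set ℕ :=
  {j | ∃ i ∈ I, lo i ≤ t ∧ t < hi i ∧ SameCluster I P εc i j}

end SLS

end

open Filter Topology

namespace SLS

/-! ### Frobenius norm -/

/-! With exact data the algorithm is correct for algebraic reasons, and compactness carries this
over to small noise without explicit constants.

Exact data. By minimality, a Hankel matrix that sees one discrete state `P` only is a product of an
observability and a controllability matrix of full rank `n`. A truncated SVD with positive singular
values is another such factorization (`IsTruncatedSVD.eq_mul_of_factorization`), so the realized
state is `P` in coordinates changed by an invertible `T`. Hence it has the same eigenvalue feature,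
and the loops compare `C(ℓ) T⁻¹` with `C T⁻¹` and `T B(ℓ)` with `T B`. The product inside `h(k, ℓ)`
runs over the times strictly between `ℓ` and `k`; these formulas therefore still hold at the switch
ending the segment and at the last time before the segment, where detectability makes one of the
compared terms differ.

Small noise. If a bound failed for every noise level, there would be records with noise tending to
zero that violate it. Orthonormal factors lie in a compact set, so along a subsequence the SVDs
converge to an SVD of the exact Hankel matrix, and consistency of the `U` makes the limits at `γ`
and `γ + 1` coincide (`exists_subseq_realize`). The estimates then converge to a state similar to
the true one, and every quantity tested by the algorithm converges to its exact value
(`exists_noise_bound`). Finitely many indices make the bounds uniform. The gaps at the switches,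
between the features and off the constant set do not involve the thresholds and give `τ₀`; smallness
inside the segments depends on the thresholds and gives `ε₀`.

Intervals. For small noise the quiet set equals the exact set of times at which the Hankel matrix is
constant (`exists_quietSet_eq`). What remains is combinatorics, together with
`switch_notMem_constantSet`: between long segments, constancy across a switch would force equal `A`
matrices. -/

theorem frob_nonneg {ι κ : Type*} [Fintype ι] [Fintype κ] (M : Matrix ι κ ℝ) : 0 ≤ frob M :=
  Real.sqrt_nonneg _

theorem abs_apply_le_frob {ι κ : Type*} [Fintype ι] [Fintype κ] (M : Matrix ι κ ℝ) (i : ι) (j : κ) :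
    |M i j| ≤ frob M := by
  apply Real.abs_le_sqrt
  calc M i j ^ 2 ≤ ∑ j, M i j ^ 2 :=
        Finset.single_le_sum (f := fun j => M i j ^ 2) (fun _ _ => sq_nonneg _) (Finset.mem_univ j)
    _ ≤ _ := Finset.single_le_sum (f := fun i => ∑ j, M i j ^ 2)
        (fun _ _ => Finset.sum_nonneg fun _ _ => sq_nonneg _) (Finset.mem_univ i)

theorem frob_zero {ι κ : Type*} [Fintype ι] [Fintype κ] : frob (0 : Matrix ι κ ℝ) = 0 := by
  simp [frob]

theorem eq_zero_of_frob_eq_zero {ι κ : Type*} [Fintype ι] [Fintype κ] {M : Matrix ι κ ℝ}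
    (h : frob M = 0) : M = 0 := by
  ext i j
  simpa [h] using abs_apply_le_frob M i j

theorem continuous_frob {ι κ : Type*} [Fintype ι] [Fintype κ] :
    Continuous (frob : Matrix ι κ ℝ → ℝ) := by
  unfold frob
  fun_prop

theorem tendsto_of_frob_sub_le {ι κ : Type*} [Fintype ι] [Fintype κ] {X Y : ℕ → Matrix ι κ ℝ}
    {Z : Matrix ι κ ℝ} {ε : ℕ → ℝ} (hε : Tendsto ε atTop (𝓝 0)) (hY : Tendsto Y atTop (𝓝 Z))
    (h : ∀ k, frob (X k - Y k) ≤ ε k) : Tendsto X atTop (𝓝 Z) := by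
  have h0 : Tendsto (fun k => X k - Y k) atTop (𝓝 0) := by
    refine tendsto_pi_nhds.2 fun i => tendsto_pi_nhds.2 fun j => ?_
    exact squeeze_zero_norm (fun k => (abs_apply_le_frob _ i j).trans (h k)) hε
  simpa using h0.add hY

/-! ### One-sided inverses -/

/-- If `XᵀX v = 0`, then `|X v|² = v · XᵀX v = 0`, so the Gram matrix inherits the trivial kernel of
`X`. -/
theorem isUnit_det_gram {ι κ : Type*} [Fintype ι] [Fintype κ] [DecidableEq κ] {X : Matrix ι κ ℝ}
    (h : ∀ v, X *ᵥ v = 0 → v = 0) : IsUnit (Xᵀ * X).det := by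
  rw [isUnit_iff_ne_zero]
  intro h0
  obtain ⟨v, hv, hv0⟩ := exists_mulVec_eq_zero_iff.2 h0
  apply hv
  apply h
  rw [← dotProduct_self_eq_zero, dotProduct_mulVec, vecMul_mulVec, ← dotProduct_mulVec]
  rw [hv0, dotProduct_zero]

theorem isUnit_det_gram_of_leftInverse {ι κ : Type*} [Fintype ι] [Fintype κ] [DecidableEq κ]
    {X : Matrix ι κ ℝ} {L : Matrix κ ι ℝ} (h : L * X = 1) : IsUnit (Xᵀ * X).det :=
  isUnit_det_gram fun v hv => by
    rw [← one_mulVec v, ← h, ← mulVec_mulVec, hv, mulVec_zero]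

theorem leftPinv_mul {ι κ : Type*} [Fintype ι] [Fintype κ] [DecidableEq κ] {X : Matrix ι κ ℝ}
    (h : IsUnit (Xᵀ * X).det) : leftPinv X * X = 1 := by
  rw [leftPinv, Matrix.mul_assoc, nonsing_inv_mul _ h]

theorem mul_rightPinv {ι κ : Type*} [Fintype ι] [Fintype κ] [DecidableEq ι] {X : Matrix ι κ ℝ}
    (h : IsUnit (X * Xᵀ).det) : X * rightPinv X = 1 := by
  rw [rightPinv, ← Matrix.mul_assoc, mul_nonsing_inv _ h]

theorem isUnit_det_gram_of_rightInverse {ι κ : Type*} [Fintype ι] [Fintype κ] [DecidableEq ι]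
    {X : Matrix ι κ ℝ} {L : Matrix κ ι ℝ} (h : X * L = 1) : IsUnit (X * Xᵀ).det := by
  have := isUnit_det_gram_of_leftInverse (X := Xᵀ) (L := Lᵀ) (by rw [← transpose_mul, h, transpose_one])
  rwa [transpose_transpose] at this

theorem tendsto_matrix_inv {κ : Type*} [Fintype κ] [DecidableEq κ] {X : ℕ → Matrix κ κ ℝ}
    {Y : Matrix κ κ ℝ} (hX : Tendsto X atTop (𝓝 Y)) (hY : IsUnit Y.det) :
    Tendsto (fun k => (X k)⁻¹) atTop (𝓝 Y⁻¹) := by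
  simp only [Matrix.inv_def, Ring.inverse_eq_inv']
  have h1 : Tendsto (fun k => (X k).det) atTop (𝓝 Y.det) :=
    ((continuous_id.matrix_det).tendsto Y).comp hX
  have h2 : Tendsto (fun k => (X k).adjugate) atTop (𝓝 Y.adjugate) :=
    ((continuous_id.matrix_adjugate).tendsto Y).comp hX
  exact (h1.inv₀ hY.ne_zero).smul h2

theorem tendsto_matrix_mul {ι κ μ : Type*} [Fintype κ] {X : ℕ → Matrix ι κ ℝ}
    {Y : ℕ → Matrix κ μ ℝ} {X' : Matrix ι κ ℝ} {Y' : Matrix κ μ ℝ} (hX : Tendsto X atTop (𝓝 X'))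
    (hY : Tendsto Y atTop (𝓝 Y')) : Tendsto (fun k => X k * Y k) atTop (𝓝 (X' * Y')) :=
  ((continuous_fst.matrix_mul continuous_snd).tendsto (X', Y')).comp (hX.prodMk_nhds hY)

theorem tendsto_matrix_transpose {ι κ : Type*} {X : ℕ → Matrix ι κ ℝ} {Y : Matrix ι κ ℝ}
    (hX : Tendsto X atTop (𝓝 Y)) : Tendsto (fun k => (X k)ᵀ) atTop (𝓝 Yᵀ) :=
  ((continuous_id.matrix_transpose).tendsto Y).comp hX

theorem tendsto_matrix_pow {κ : Type*} [Fintype κ] [DecidableEq κ] {X : ℕ → Matrix κ κ ℝ}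
    {Y : Matrix κ κ ℝ} (hX : Tendsto X atTop (𝓝 Y)) (r : ℕ) :
    Tendsto (fun k => X k ^ r) atTop (𝓝 (Y ^ r)) := by
  induction r with
  | zero => simp
  | succ r ih => simpa only [pow_succ] using tendsto_matrix_mul ih hX

theorem tendsto_leftPinv {ι κ : Type*} [Fintype ι] [Fintype κ] [DecidableEq κ]
    {X : ℕ → Matrix ι κ ℝ} {Y : Matrix ι κ ℝ} (hX : Tendsto X atTop (𝓝 Y))
    (hY : IsUnit (Yᵀ * Y).det) : Tendsto (fun k => leftPinv (X k)) atTop (𝓝 (leftPinv Y)) :=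
  tendsto_matrix_mul (tendsto_matrix_inv (tendsto_matrix_mul (tendsto_matrix_transpose hX) hX) hY)
    (tendsto_matrix_transpose hX)

theorem tendsto_rightPinv {ι κ : Type*} [Fintype ι] [Fintype κ] [DecidableEq ι]
    {X : ℕ → Matrix ι κ ℝ} {Y : Matrix ι κ ℝ} (hX : Tendsto X atTop (𝓝 Y))
    (hY : IsUnit (Y * Yᵀ).det) : Tendsto (fun k => rightPinv (X k)) atTop (𝓝 (rightPinv Y)) :=
  tendsto_matrix_mul (tendsto_matrix_transpose hX)
    (tendsto_matrix_inv (tendsto_matrix_mul hX (tendsto_matrix_transpose hX)) hY)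

/-! ### Minimal discrete states -/

/-- The dual discrete state `(Aᵀ, Cᵀ, Bᵀ, Dᵀ)`. -/
def DiscreteState.dual {n m p : ℕ} (P : DiscreteState n m p) : DiscreteState n p m where
  A := P.Aᵀ
  B := P.Cᵀ
  C := P.Bᵀ
  D := P.Dᵀ

theorem DiscreteState.dual_obs {n m p : ℕ} (P : DiscreteState n m p) (q : ℕ) :
    P.dual.obs q = (P.ctr q)ᵀ := by
  ext x j
  simp only [DiscreteState.obs, DiscreteState.ctr, DiscreteState.dual, of_apply, transpose_apply]
  rw [← transpose_pow, ← transpose_mul, transpose_apply]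

theorem DiscreteState.obs_mul_ctr {n m p : ℕ} (P : DiscreteState n m p) (q r : ℕ) :
    P.obs q * P.ctr r = Matrix.of fun x y => (P.C * P.A ^ (x.1.val + y.1.val) * P.B) x.2 y.2 := by
  ext x y
  have : P.C * P.A ^ (x.1.val + y.1.val) * P.B = (P.C * P.A ^ x.1.val) * (P.A ^ y.1.val * P.B) := by
    simp only [pow_add, Matrix.mul_assoc]
  rw [of_apply, this]
  rfl

theorem DiscreteState.dual_hasMacmillanDegree {n m p : ℕ} {P : DiscreteState n m p} {d : ℕ}
    (h : P.HasMacmillanDegree d) : P.dual.HasMacmillanDegree d := by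
  have key : ∀ r, (P.dual.impulseHankel r).rank = (P.impulseHankel r).rank := by
    intro r
    rw [← rank_transpose (P.impulseHankel r)]
    congr 1
    ext x y
    simp only [DiscreteState.impulseHankel, DiscreteState.dual, of_apply, transpose_apply]
    rw [← transpose_pow, ← transpose_mul, ← transpose_mul, transpose_apply, add_comm,
      Matrix.mul_assoc]
  unfold DiscreteState.HasMacmillanDegree at *
  simpa only [key] using h

theorem DiscreteState.obs_mulVec_eq_zero_iff {n m p : ℕ} (P : DiscreteState n m p) (q : ℕ)
    (v : Fin n → ℝ) : P.obs q *ᵥ v = 0 ↔ ∀ s < q, (P.C * P.A ^ s) *ᵥ v = 0 := by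
  constructor
  · intro h s hs
    ext a
    exact congrFun h (⟨s, hs⟩, a)
  · intro h
    ext x
    exact congrFun (h x.1.val x.1.isLt) x.2

/-- Cayley–Hamilton: `A ^ s` is a combination of the powers below `n`. -/
theorem DiscreteState.mulVec_eq_zero_of_lt {n m p : ℕ} (P : DiscreteState n m p) (v : Fin n → ℝ)
    (h : ∀ s < n, (P.C * P.A ^ s) *ᵥ v = 0) (s : ℕ) : (P.C * P.A ^ s) *ᵥ v = 0 := by
  -- For `n = 0` the characteristic polynomial is `1`, and the strict degree bound on the remainder
  -- fails.
  rcases Nat.eq_zero_or_pos n with rfl | hn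
  · have : v = 0 := Subsingleton.elim _ _
    rw [this, mulVec_zero]
  rw [Matrix.pow_eq_aeval_mod_charpoly, Polynomial.aeval_eq_sum_range' (n := n), Matrix.mul_sum,
    Matrix.sum_mulVec]
  · refine Finset.sum_eq_zero fun i hi => ?_
    rw [Matrix.mul_smul, Matrix.smul_mulVec, h i (Finset.mem_range.1 hi), smul_zero]
  · have := Polynomial.natDegree_modByMonic_lt (Polynomial.X ^ s) (Matrix.charpoly_monic P.A) (by
      intro h1
      have := P.A.charpoly_natDegree_eq_dim
      rw [h1] at this
      simp at this
      omega)
    rwa [P.A.charpoly_natDegree_eq_dim, Fintype.card_fin] at this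

/-- Some Hankel section `obs r * ctr r` has rank `n`, hence `obs r` has trivial kernel. That `r` is
unrelated to `q`; Cayley–Hamilton shows that the first `n` block rows already have the same kernel.
-/
theorem DiscreteState.isUnit_det_obs {n m p : ℕ} {P : DiscreteState n m p}
    (h : P.HasMacmillanDegree n) {q : ℕ} (hq : n ≤ q) : IsUnit ((P.obs q)ᵀ * P.obs q).det := by
  obtain ⟨⟨r, hr⟩, -⟩ := h
  have hfac : P.impulseHankel r = P.obs r * P.ctr r := (P.obs_mul_ctr r r).symm
  have hrank : n ≤ (P.obs r).rank := by
    have : (P.impulseHankel r).rank = n := hr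
    rw [hfac] at this
    exact this.ge.trans (rank_mul_le_left _ _)
  have hker : ∀ v, P.obs r *ᵥ v = 0 → v = 0 := by
    have h1 := LinearMap.finrank_range_add_finrank_ker (P.obs r).mulVecLin
    have h2 : Module.finrank ℝ (LinearMap.range (P.obs r).mulVecLin) = (P.obs r).rank := rfl
    rw [Module.finrank_fin_fun] at h1
    have h3 : Module.finrank ℝ (LinearMap.ker (P.obs r).mulVecLin) = 0 := by omega
    have h4 := Submodule.finrank_eq_zero.1 h3
    intro v hv
    have : v ∈ LinearMap.ker (P.obs r).mulVecLin := by simpa using hv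
    rw [h4] at this
    simpa using this
  refine isUnit_det_gram fun v hv => hker v ?_
  rw [DiscreteState.obs_mulVec_eq_zero_iff] at hv ⊢
  exact fun s _ => P.mulVec_eq_zero_of_lt v (fun s hs => hv s (hs.trans_le hq)) s

theorem DiscreteState.isUnit_det_ctr {n m p : ℕ} {P : DiscreteState n m p}
    (h : P.HasMacmillanDegree n) {q : ℕ} (hq : n ≤ q) : IsUnit (P.ctr q * (P.ctr q)ᵀ).det := by
  have := DiscreteState.isUnit_det_obs (DiscreteState.dual_hasMacmillanDegree h) hq
  rwa [DiscreteState.dual_obs, transpose_transpose] at this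

theorem eq_of_mul_right_eq {ι κ μ : Type*} [Fintype κ] [Fintype μ] [DecidableEq κ]
    {X Y : Matrix ι κ ℝ} {R : Matrix κ μ ℝ} (hR : IsUnit (R * Rᵀ).det) (h : X * R = Y * R) :
    X = Y := by
  have := congrArg (· * rightPinv R) h
  simpa [Matrix.mul_assoc, mul_rightPinv hR] using this

theorem eq_of_mul_left_eq {ι κ μ : Type*} [Fintype κ] [Fintype μ] [DecidableEq κ]
    {X Y : Matrix κ ι ℝ} {L : Matrix μ κ ℝ} (hL : IsUnit (Lᵀ * L).det) (h : L * X = L * Y) :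
    X = Y := by
  have := congrArg (leftPinv L * ·) h
  simpa [← Matrix.mul_assoc, leftPinv_mul hL] using this

/-! ### Similar realizations -/

/-- `Q` is obtained from `P` by a change of the coordinates of the state space. -/
def Similar {n m p : ℕ} (P Q : DiscreteState n m p) : Prop :=
  ∃ T : Matrix (Fin n) (Fin n) ℝ, IsUnit T.det ∧ Q.A * T = T * P.A ∧ Q.B = T * P.B ∧
    Q.C * T = P.C ∧ Q.D = P.D

theorem Similar.eigSum_eq {n m p : ℕ} {P Q : DiscreteState n m p} (h : Similar P Q) :
    eigSum Q.A = eigSum P.A := by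
  obtain ⟨T, hT, hA, -⟩ := h
  have h1 : Q.A = T * P.A * T⁻¹ := by
    rw [← hA, Matrix.mul_assoc, mul_nonsing_inv _ hT, Matrix.mul_one]
  have h2 : Q.A.charpoly = P.A.charpoly := by
    have := Matrix.charpoly_units_conj (T.nonsingInvUnit hT) P.A
    rw [h1, ← this]
    rfl
  unfold eigSum
  rw [Matrix.charpoly_map, Matrix.charpoly_map, h2]

theorem mul_pow_eq_of_mul_eq {κ : Type*} [Fintype κ] [DecidableEq κ] {A A' T : Matrix κ κ ℝ}
    (h : A' * T = T * A) (s : ℕ) : A' ^ s * T = T * A ^ s := by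
  induction s with
  | zero => simp
  | succ s ih => rw [pow_succ, Matrix.mul_assoc, h, ← Matrix.mul_assoc, ih, Matrix.mul_assoc, pow_succ]

theorem ctr_eq_of_similar {n m p : ℕ} {P Q : DiscreteState n m p} {T : Matrix (Fin n) (Fin n) ℝ}
    (hA : Q.A * T = T * P.A) (hB : Q.B = T * P.B) (r : ℕ) : Q.ctr r = T * P.ctr r := by
  ext i y
  have : Q.A ^ y.1.val * Q.B = T * (P.A ^ y.1.val * P.B) := by
    rw [hB, ← Matrix.mul_assoc, mul_pow_eq_of_mul_eq hA, Matrix.mul_assoc]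
  simp only [DiscreteState.ctr, of_apply, this]
  rfl

theorem obs_mul_eq_of_similar {n m p : ℕ} {P Q : DiscreteState n m p}
    {T : Matrix (Fin n) (Fin n) ℝ} (hA : Q.A * T = T * P.A) (hC : Q.C * T = P.C) (q : ℕ) :
    Q.obs q * T = P.obs q := by
  ext x j
  have : P.C * P.A ^ x.1.val = Q.C * Q.A ^ x.1.val * T := by
    rw [← hC, Matrix.mul_assoc, Matrix.mul_assoc, mul_pow_eq_of_mul_eq hA]
  simp only [DiscreteState.obs, of_apply, this]
  rfl

/-! ### Truncated singular value decompositions -/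

theorem IsTruncatedSVD.diagonal_eq {ι κ : Type*} [Fintype ι] [Fintype κ] {n : ℕ}
    {M : Matrix ι κ ℝ} {U : Matrix ι (Fin n) ℝ} {s : Fin n → ℝ} {V : Matrix κ (Fin n) ℝ}
    (h : IsTruncatedSVD M U s V) : Uᵀ * M * V = diagonal s := by
  rw [Matrix.mul_assoc, h.mul_right, ← Matrix.mul_assoc, h.orth_left, Matrix.one_mul]

theorem IsTruncatedSVD.transpose_mul_eq {ι κ : Type*} [Fintype ι] [Fintype κ] {n : ℕ}
    {M : Matrix ι κ ℝ} {U : Matrix ι (Fin n) ℝ} {s : Fin n → ℝ} {V : Matrix κ (Fin n) ℝ}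
    (h : IsTruncatedSVD M U s V) : Uᵀ * M = diagonal s * Vᵀ := by
  have := congrArg transpose h.mul_left
  simpa [transpose_mul] using this

theorem abs_le_one_of_transpose_mul_self {ι : Type*} [Fintype ι] {n : ℕ}
    {U : Matrix ι (Fin n) ℝ} (h : Uᵀ * U = 1) (i : ι) (j : Fin n) : U i j ∈ Set.Icc (-1 : ℝ) 1 := by
  have h1 := congrFun (congrFun h j) j
  simp only [mul_apply, transpose_apply, one_apply_eq] at h1
  rw [Set.mem_Icc, ← abs_le]
  have h2 : U i j * U i j ≤ 1 := by
    rw [← h1]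
    exact Finset.single_le_sum (f := fun i => U i j * U i j) (fun _ _ => mul_self_nonneg _)
      (Finset.mem_univ i)
  exact abs_le_one_iff_mul_self_le_one.2 h2

theorem exists_subseq_tendsto_of_orthonormal {ι : Type*} [Fintype ι] {n : ℕ}
    {U : ℕ → Matrix ι (Fin n) ℝ} (h : ∀ k, (U k)ᵀ * U k = 1) :
    ∃ (U' : Matrix ι (Fin n) ℝ) (ψ : ℕ → ℕ), StrictMono ψ ∧
      Tendsto (fun k => U (ψ k)) atTop (𝓝 U') := by
  have hc : IsCompact (Set.univ.pi fun _ : ι => Set.univ.pi fun _ : Fin n => Set.Icc (-1 : ℝ) 1) :=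
    isCompact_univ_pi fun _ => isCompact_univ_pi fun _ => isCompact_Icc
  obtain ⟨U', -, ψ, hψ, hU⟩ := hc.tendsto_subseq (x := fun k i j => U k i j) fun k i _ j _ =>
    abs_le_one_of_transpose_mul_self (h k) i j
  exact ⟨U', ψ, hψ, hU⟩

theorem tendsto_diag {n : ℕ} {X : ℕ → Fin n → ℝ} {Y : Matrix (Fin n) (Fin n) ℝ}
    (h : Tendsto (fun k => diagonal (X k)) atTop (𝓝 Y)) : Tendsto X atTop (𝓝 Y.diag) := by
  refine tendsto_pi_nhds.2 fun j => ?_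
  have := tendsto_pi_nhds.1 (tendsto_pi_nhds.1 h j) j
  simpa using this

theorem tendsto_diagonal {n : ℕ} {X : ℕ → Fin n → ℝ} {Y : Fin n → ℝ}
    (h : Tendsto X atTop (𝓝 Y)) : Tendsto (fun k => diagonal (X k)) atTop (𝓝 (diagonal Y)) :=
  ((continuous_id.matrix_diagonal).tendsto Y).comp h

/-- The singular values are the diagonal of `UᵀMV`, so they need no compactness argument of their
own. -/
theorem IsTruncatedSVD.tendsto_singularValues {ι κ : Type*} [Fintype ι] [Fintype κ] {n : ℕ}
    {M : ℕ → Matrix ι κ ℝ} {U : ℕ → Matrix ι (Fin n) ℝ} {s : ℕ → Fin n → ℝ}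
    {V : ℕ → Matrix κ (Fin n) ℝ} {M' : Matrix ι κ ℝ} {U' : Matrix ι (Fin n) ℝ}
    {V' : Matrix κ (Fin n) ℝ} (h : ∀ k, IsTruncatedSVD (M k) (U k) (s k) (V k))
    (hM : Tendsto M atTop (𝓝 M')) (hU : Tendsto U atTop (𝓝 U')) (hV : Tendsto V atTop (𝓝 V')) :
    Tendsto s atTop (𝓝 (U'ᵀ * M' * V').diag) := by
  apply tendsto_diag
  have := tendsto_matrix_mul (tendsto_matrix_mul (tendsto_matrix_transpose hU) hM) hV
  exact this.congr fun k => (h k).diagonal_eq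

/-- The defining conditions are closed in `(M, U, s, V)`. Only dominance needs care, because its
test vectors depend on `V`. -/
theorem IsTruncatedSVD.of_tendsto {ι κ : Type*} [Fintype ι] [Fintype κ] {n : ℕ}
    {M : ℕ → Matrix ι κ ℝ} {U : ℕ → Matrix ι (Fin n) ℝ} {s : ℕ → Fin n → ℝ}
    {V : ℕ → Matrix κ (Fin n) ℝ} {M' : Matrix ι κ ℝ} {U' : Matrix ι (Fin n) ℝ} {s' : Fin n → ℝ}
    {V' : Matrix κ (Fin n) ℝ} (h : ∀ k, IsTruncatedSVD (M k) (U k) (s k) (V k))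
    (hM : Tendsto M atTop (𝓝 M')) (hU : Tendsto U atTop (𝓝 U')) (hs : Tendsto s atTop (𝓝 s'))
    (hV : Tendsto V atTop (𝓝 V')) : IsTruncatedSVD M' U' s' V' where
  orth_left := tendsto_nhds_unique ((tendsto_matrix_mul (tendsto_matrix_transpose hU) hU).congr
    fun k => (h k).orth_left) tendsto_const_nhds
  orth_right := tendsto_nhds_unique ((tendsto_matrix_mul (tendsto_matrix_transpose hV) hV).congr
    fun k => (h k).orth_right) tendsto_const_nhds
  nonneg j := ge_of_tendsto' (tendsto_pi_nhds.1 hs j) fun k => (h k).nonneg j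
  antitone i j hij := le_of_tendsto_of_tendsto' (tendsto_pi_nhds.1 hs j) (tendsto_pi_nhds.1 hs i)
    fun k => (h k).antitone hij
  mul_right := tendsto_nhds_unique ((tendsto_matrix_mul hM hV).congr fun k => (h k).mul_right)
    (tendsto_matrix_mul hU (tendsto_diagonal hs))
  mul_left := tendsto_nhds_unique ((tendsto_matrix_mul (tendsto_matrix_transpose hM) hU).congr
    fun k => (h k).mul_left) (tendsto_matrix_mul hV (tendsto_diagonal hs))
  dominant x hx j := by
    -- `x` is projected to the orthogonal complement of the columns of `V k`
    have hy : Tendsto (fun k => x - V k *ᵥ ((V k)ᵀ *ᵥ x)) atTop (𝓝 x) := by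
      have hc : Continuous fun W : Matrix κ (Fin n) ℝ => x - W *ᵥ (Wᵀ *ᵥ x) := by fun_prop
      have := (hc.tendsto V').comp hV
      simpa [hx, Function.comp_def] using this
    have hc1 : Continuous fun q : Matrix ι κ ℝ × (κ → ℝ) => (q.1 *ᵥ q.2) ⬝ᵥ (q.1 *ᵥ q.2) := by
      fun_prop
    have hc2 : Continuous fun q : (Fin n → ℝ) × (κ → ℝ) => q.1 j ^ 2 * (q.2 ⬝ᵥ q.2) := by
      fun_prop
    refine le_of_tendsto_of_tendsto' ((hc1.tendsto (M', x)).comp (hM.prodMk_nhds hy))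
      ((hc2.tendsto (s', x)).comp (hs.prodMk_nhds hy)) fun k => (h k).dominant _ ?_ j
    rw [mulVec_sub, mulVec_mulVec, (h k).orth_right, one_mulVec, sub_self]

/-- The matrix has rank exactly `n`, so `n` dominant singular triples exhaust it. -/
theorem IsTruncatedSVD.eq_mul_of_factorization {ι κ : Type*} [Fintype ι] [Fintype κ] {n : ℕ}
    {O : Matrix ι (Fin n) ℝ} {R : Matrix (Fin n) κ ℝ} {U : Matrix ι (Fin n) ℝ} {s : Fin n → ℝ}
    {V : Matrix κ (Fin n) ℝ} (hO : IsUnit (Oᵀ * O).det) (hR : IsUnit (R * Rᵀ).det)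
    (h : IsTruncatedSVD (O * R) U s V) : (∀ j, 0 < s j) ∧ O * R = U * diagonal s * Vᵀ := by
  have hpos : ∀ j, 0 < s j := by
    intro j
    refine lt_of_le_of_ne (h.nonneg j) fun hj => ?_
    -- A vanishing kept singular value forces, by dominance, all omitted ones to vanish. Then `O *
    -- R` factors through the singular `diagonal s`, while one-sided inverses of `O` and `R` turn it
    -- into the identity.
    have h0 : ∀ x, Vᵀ *ᵥ x = 0 → (O * R) *ᵥ x = 0 := by
      intro x hx
      have := h.dominant x hx j
      rw [← hj] at this
      rw [← dotProduct_self_eq_zero]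
      refine le_antisymm (by simpa using this) ?_
      exact Finset.sum_nonneg fun _ _ => mul_self_nonneg _
    classical
    have h1 : O * R = U * diagonal s * Vᵀ := by
      rw [← h.mul_right]
      refine Matrix.ext_of_mulVec_single fun i => ?_
      have := h0 (Pi.single i 1 - V *ᵥ (Vᵀ *ᵥ Pi.single i 1)) (by
        rw [mulVec_sub, mulVec_mulVec, h.orth_right, one_mulVec, sub_self])
      rw [mulVec_sub, sub_eq_zero] at this
      rw [this, mulVec_mulVec, mulVec_mulVec, Matrix.mul_assoc (O * R)]
    have h2 : (leftPinv O * U) * diagonal s * (Vᵀ * rightPinv R) = 1 := by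
      calc _ = leftPinv O * (U * diagonal s * Vᵀ) * rightPinv R := by simp only [Matrix.mul_assoc]
        _ = (leftPinv O * O) * (R * rightPinv R) := by rw [← h1]; simp only [Matrix.mul_assoc]
        _ = 1 := by rw [leftPinv_mul hO, mul_rightPinv hR, Matrix.one_mul]
    have h3 := congrArg det h2
    rw [det_mul, det_mul, det_diagonal, det_one, Finset.prod_eq_zero (Finset.mem_univ j) hj.symm]
      at h3
    simp at h3
  refine ⟨hpos, ?_⟩
  -- With positive `s`, the columns of `U` lie in the range of `O`; as `W` is square, it is
  -- invertible and the two ranges agree. Hence `U * Uᵀ` fixes `O`.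
  set W := R * V * diagonal fun j => (s j)⁻¹ with hW
  have hU : U = O * W := by
    have h1 : diagonal s * diagonal (fun j => (s j)⁻¹) = (1 : Matrix (Fin n) (Fin n) ℝ) := by
      rw [diagonal_mul_diagonal, ← diagonal_one]
      congr 1
      ext j
      exact mul_inv_cancel₀ (hpos j).ne'
    calc U = U * (diagonal s * diagonal fun j => (s j)⁻¹) := by rw [h1, Matrix.mul_one]
      _ = O * W := by rw [← Matrix.mul_assoc, ← h.mul_right, hW]; simp only [Matrix.mul_assoc]
  have h1 : (Uᵀ * O) * W = 1 := by rw [Matrix.mul_assoc, ← hU, h.orth_left]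
  have h2 : W * (Uᵀ * O) = 1 := mul_eq_one_comm.1 h1
  have h3 : O = U * (Uᵀ * O) := by
    conv_lhs => rw [← Matrix.mul_one O, ← h2, ← Matrix.mul_assoc, ← hU]
  calc O * R = U * (Uᵀ * (O * R)) := by
        conv_lhs => rw [h3]
        simp only [Matrix.mul_assoc]
    _ = _ := by rw [h.transpose_mul_eq, Matrix.mul_assoc]

/-- For a given `U`, the product `V * diagonal s = Mᵀ * U` is determined. Its Gram matrix gives
`s²`, and dividing by `s > 0` gives `V`. -/
theorem IsTruncatedSVD.right_unique {ι κ : Type*} [Fintype ι] [Fintype κ] {n : ℕ}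
    {M : Matrix ι κ ℝ} {U : Matrix ι (Fin n) ℝ} {s s' : Fin n → ℝ} {V V' : Matrix κ (Fin n) ℝ}
    (hs' : ∀ j, 0 < s' j) (h : IsTruncatedSVD M U s V) (h' : IsTruncatedSVD M U s' V') :
    s = s' ∧ V = V' := by
  have h1 : V * diagonal s = V' * diagonal s' := by rw [← h.mul_left, h'.mul_left]
  have hsq : ∀ {W : Matrix κ (Fin n) ℝ} {t : Fin n → ℝ}, Wᵀ * W = 1 →
      (W * diagonal t)ᵀ * (W * diagonal t) = diagonal fun j => t j * t j := by
    intro W t hW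
    rw [transpose_mul, Matrix.mul_assoc, ← Matrix.mul_assoc Wᵀ, hW, Matrix.one_mul,
      diagonal_transpose, diagonal_mul_diagonal]
  have h2 := hsq (t := s) h.orth_right
  rw [h1, hsq h'.orth_right] at h2
  have h3 : s = s' := by
    ext j
    have := congrFun (diagonal_injective h2) j
    exact (mul_self_inj (h.nonneg j) (h'.nonneg j)).1 this.symm
  refine ⟨h3, ?_⟩
  ext i j
  have := congrFun (congrFun h1 i) j
  rw [mul_diagonal, mul_diagonal, h3] at this
  exact mul_right_cancel₀ (hs' j).ne' this

/-! ### Convergence of the estimates -/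

/-- Convergence of discrete states, matrix by matrix. -/
structure StateTendsto {n m p : ℕ} (P : ℕ → DiscreteState n m p) (Q : DiscreteState n m p) :
    Prop where
  A : Tendsto (fun k => (P k).A) atTop (𝓝 Q.A)
  B : Tendsto (fun k => (P k).B) atTop (𝓝 Q.B)
  C : Tendsto (fun k => (P k).C) atTop (𝓝 Q.C)
  D : Tendsto (fun k => (P k).D) atTop (𝓝 Q.D)

theorem sqrt_diagonal_mul_self {n : ℕ} {s : Fin n → ℝ} (hs : ∀ j, 0 < s j) :
    (diagonal fun j => Real.sqrt (s j)) * (diagonal fun j => Real.sqrt (s j)) = diagonal s := by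
  rw [diagonal_mul_diagonal]
  congr 1
  ext j
  exact Real.mul_self_sqrt (hs j).le

theorem det_sqrt_diagonal_isUnit {n : ℕ} {s : Fin n → ℝ} (hs : ∀ j, 0 < s j) :
    IsUnit (diagonal fun j => Real.sqrt (s j)).det := by
  rw [det_diagonal, isUnit_iff_ne_zero, Finset.prod_ne_zero_iff]
  exact fun j _ => (Real.sqrt_pos.2 (hs j)).ne'

/-- Two factorizations of full rank differ by an invertible matrix. -/
theorem exists_isUnit_of_factorization {ι κ : Type*} [Fintype ι] [Fintype κ] {n : ℕ}
    {O O' : Matrix ι (Fin n) ℝ} {R R' : Matrix (Fin n) κ ℝ} (hO : IsUnit (Oᵀ * O).det)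
    (hO' : IsUnit (O'ᵀ * O').det) (hR : IsUnit (R * Rᵀ).det) (h : O' * R' = O * R) :
    ∃ T : Matrix (Fin n) (Fin n) ℝ, IsUnit T.det ∧ O' * T = O ∧ R' = T * R := by
  have h1 : R' = leftPinv O' * O * R := by
    rw [Matrix.mul_assoc, ← h, ← Matrix.mul_assoc, leftPinv_mul hO', Matrix.one_mul]
  have h2 : O' * (leftPinv O' * O) = O := by
    refine eq_of_mul_right_eq hR ?_
    rw [Matrix.mul_assoc, ← h1, h]
  refine ⟨leftPinv O' * O, ?_, h2, h1⟩
  refine isUnit_det_of_left_inverse (B := leftPinv O * O') ?_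
  rw [Matrix.mul_assoc, h2, leftPinv_mul hO]

theorem selC_mul_apply {q p n : ℕ} (X : Matrix (Fin (q + 1) × Fin p) (Fin n) ℝ) (a : Fin p)
    (j : Fin n) : (selC (q + 1) p * X) a j = X (0, a) j := by
  rw [mul_apply, Finset.sum_eq_single (0, a)]
  · simp [selC]
  · rintro ⟨x, b⟩ - hx
    simp only [selC, of_apply, ite_mul, one_mul, zero_mul, ite_eq_right_iff]
    rintro ⟨h1, rfl⟩
    exact (hx (Prod.ext (Fin.ext h1) rfl)).elim
  · simp

theorem mul_selB_apply {r m n : ℕ} (hr : 0 < r) (X : Matrix (Fin n) (Fin r × Fin m) ℝ) (i : Fin n)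
    (b : Fin m) : (X * selB r m) i b = X i (⟨0, hr⟩, b) := by
  rw [mul_apply, Finset.sum_eq_single (⟨0, hr⟩, b)]
  · simp [selB]
  · rintro ⟨x, c⟩ - hx
    simp only [selB, of_apply, mul_ite, mul_one, mul_zero, ite_eq_right_iff]
    rintro ⟨h1, rfl⟩
    exact (hx (Prod.ext (Fin.ext h1) rfl)).elim
  · simp

theorem selC_mul_obs {n m p : ℕ} (P : DiscreteState n m p) (q : ℕ) :
    selC (q + 1) p * P.obs (q + 1) = P.C := by
  ext a j
  rw [selC_mul_apply]
  simp [DiscreteState.obs]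

theorem ctr_mul_selB {n m p : ℕ} (P : DiscreteState n m p) {r : ℕ} (hr : 0 < r) :
    P.ctr r * selB r m = P.B := by
  ext i b
  rw [mul_selB_apply hr]
  simp [DiscreteState.ctr]

theorem dropLast_obs {n m p : ℕ} (P : DiscreteState n m p) (q : ℕ) :
    dropLast (P.obs (q + 1)) = P.obs q := rfl

theorem dropFirst_obs {n m p : ℕ} (P : DiscreteState n m p) (q : ℕ) :
    dropFirst (P.obs (q + 1)) = P.obs q * P.A := by
  ext x j
  have : P.C * P.A ^ (x.1.val + 1) = P.C * P.A ^ x.1.val * P.A := by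
    rw [pow_succ, Matrix.mul_assoc]
  simp only [dropFirst, submatrix_apply, DiscreteState.obs, of_apply, Fin.val_succ, id, this]
  rfl

theorem dropLast_mul {q p n : ℕ} (X : Matrix (Fin (q + 1) × Fin p) (Fin n) ℝ)
    (T : Matrix (Fin n) (Fin n) ℝ) : dropLast (X * T) = dropLast X * T := rfl

theorem dropFirst_mul {q p n : ℕ} (X : Matrix (Fin (q + 1) × Fin p) (Fin n) ℝ)
    (T : Matrix (Fin n) (Fin n) ℝ) : dropFirst (X * T) = dropFirst X * T := rfl

/-- The estimate of `A` combines observability factors from two SVDs, and SVDs are not unique. Equal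
limits of the two `U` put both factors in the same coordinates, so the shift structure of `P.obs`
survives in the limit. -/
theorem exists_subseq_realize {n m p : ℕ} (hn : 0 < n) {P : DiscreteState n m p}
    (hP : P.HasMacmillanDegree n) {γ : ℕ} {h : ℕ → ℕ → ℕ → Matrix (Fin p) (Fin m) ℝ}
    {U : ℕ → ℕ → Matrix (Fin (2 * n + 1) × Fin p) (Fin n) ℝ} {s : ℕ → ℕ → Fin n → ℝ}
    {V : ℕ → ℕ → Matrix (Fin (2 * n) × Fin m) (Fin n) ℝ}
    (h0 : ∀ k, IsTruncatedSVD (hankel (h k) (2 * n + 1) (2 * n) γ) (U k γ) (s k γ) (V k γ))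
    (h1 : ∀ k, IsTruncatedSVD (hankel (h k) (2 * n + 1) (2 * n) (γ + 1)) (U k (γ + 1))
      (s k (γ + 1)) (V k (γ + 1)))
    (hH0 : Tendsto (fun k => hankel (h k) (2 * n + 1) (2 * n) γ) atTop
      (𝓝 (P.obs (2 * n + 1) * P.ctr (2 * n))))
    (hH1 : Tendsto (fun k => hankel (h k) (2 * n + 1) (2 * n) (γ + 1)) atTop
      (𝓝 (P.obs (2 * n + 1) * P.ctr (2 * n))))
    (hD : Tendsto (fun k => h k γ γ) atTop (𝓝 P.D)) {ε : ℕ → ℝ} (hε : Tendsto ε atTop (𝓝 0))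
    (hU : ∀ k, frob (U k (γ + 1) - U k γ) ≤ ε k) :
    ∃ (ψ : ℕ → ℕ) (Q : DiscreteState n m p), StrictMono ψ ∧ Similar P Q ∧
      StateTendsto (fun k => realize (h (ψ k)) (U (ψ k)) (s (ψ k)) (V (ψ k)) γ) Q := by
  obtain ⟨U', ψ₁, hψ₁, hU'⟩ := exists_subseq_tendsto_of_orthonormal fun k => (h0 k).orth_left
  obtain ⟨V', ψ₂, hψ₂, hV'⟩ := exists_subseq_tendsto_of_orthonormal fun k => (h0 (ψ₁ k)).orth_right
  obtain ⟨V'', ψ₃, hψ₃, hV''⟩ :=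
    exists_subseq_tendsto_of_orthonormal fun k => (h1 (ψ₁ (ψ₂ k))).orth_right
  set ψ : ℕ → ℕ := fun k => ψ₁ (ψ₂ (ψ₃ k)) with hψ
  have hmono : StrictMono ψ := hψ₁.comp (hψ₂.comp hψ₃)
  have hUa : Tendsto (fun k => U (ψ k) γ) atTop (𝓝 U') :=
    hU'.comp (hψ₂.comp hψ₃).tendsto_atTop
  have hVa : Tendsto (fun k => V (ψ k) γ) atTop (𝓝 V') := hV'.comp hψ₃.tendsto_atTop
  have hVb : Tendsto (fun k => V (ψ k) (γ + 1)) atTop (𝓝 V'') := hV''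
  have hUb : Tendsto (fun k => U (ψ k) (γ + 1)) atTop (𝓝 U') :=
    tendsto_of_frob_sub_le (hε.comp hmono.tendsto_atTop) hUa fun k => hU (ψ k)
  have hMa := hH0.comp hmono.tendsto_atTop
  have hMb := hH1.comp hmono.tendsto_atTop
  have hsa := IsTruncatedSVD.tendsto_singularValues (fun k => h0 (ψ k)) hMa hUa hVa
  have hsb := IsTruncatedSVD.tendsto_singularValues (fun k => h1 (ψ k)) hMb hUb hVb
  have hSa := IsTruncatedSVD.of_tendsto (fun k => h0 (ψ k)) hMa hUa hsa hVa
  have hSb := IsTruncatedSVD.of_tendsto (fun k => h1 (ψ k)) hMb hUb hsb hVb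
  have hO := DiscreteState.isUnit_det_obs hP (q := 2 * n + 1) (by omega)
  have hO2 := DiscreteState.isUnit_det_obs hP (q := 2 * n) (by omega)
  have hR := DiscreteState.isUnit_det_ctr hP (q := 2 * n) (by omega)
  obtain ⟨hpos, hfac⟩ := hSa.eq_mul_of_factorization hO hR
  -- Both limits decompose the same matrix with the same `U'`, so their singular values and right
  -- factors coincide too.
  obtain ⟨hss, hVV⟩ := IsTruncatedSVD.right_unique hpos hSb hSa
  rw [hss, hVV] at hSb
  rw [hss] at hsb
  rw [hVV] at hVb
  set t := (U'ᵀ * (P.obs (2 * n + 1) * P.ctr (2 * n)) * V').diag with ht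
  have hOe : IsUnit ((obsEst U' t)ᵀ * obsEst U' t).det := by
    refine isUnit_det_gram_of_leftInverse (L := (diagonal fun j => Real.sqrt (t j))⁻¹ * U'ᵀ) ?_
    rw [obsEst, Matrix.mul_assoc, ← Matrix.mul_assoc U'ᵀ, hSa.orth_left, Matrix.one_mul,
      nonsing_inv_mul _ (det_sqrt_diagonal_isUnit hpos)]
  obtain ⟨T, hT, hOT, hRT⟩ := exists_isUnit_of_factorization hO hOe hR
    (R' := ctrEst t V') (by
      rw [hfac, obsEst, ctrEst, Matrix.mul_assoc, ← Matrix.mul_assoc (diagonal _),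
        sqrt_diagonal_mul_self hpos, Matrix.mul_assoc])
  have hsq : ∀ {x : ℕ → Fin n → ℝ}, Tendsto x atTop (𝓝 t) →
      Tendsto (fun k => diagonal fun j => Real.sqrt (x k j)) atTop
        (𝓝 (diagonal fun j => Real.sqrt (t j))) := by
    intro x hx
    apply tendsto_diagonal
    refine tendsto_pi_nhds.2 fun j => ?_
    exact (Real.continuous_sqrt.tendsto _).comp (tendsto_pi_nhds.1 hx j)
  have hOa : Tendsto (fun k => obsEst (U (ψ k) γ) (s (ψ k) γ)) atTop (𝓝 (obsEst U' t)) :=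
    tendsto_matrix_mul hUa (hsq hsa)
  have hOb : Tendsto (fun k => obsEst (U (ψ k) (γ + 1)) (s (ψ k) (γ + 1))) atTop
      (𝓝 (obsEst U' t)) := tendsto_matrix_mul hUb (hsq hsb)
  have hRb : Tendsto (fun k => ctrEst (s (ψ k) (γ + 1)) (V (ψ k) (γ + 1))) atTop
      (𝓝 (ctrEst t V')) := tendsto_matrix_mul (hsq hsb) (tendsto_matrix_transpose hVb)
  have hdl : dropLast (obsEst U' t) * T = P.obs (2 * n) := by
    rw [← dropLast_mul, hOT, dropLast_obs]
  have hdf : dropFirst (obsEst U' t) * T = P.obs (2 * n) * P.A := by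
    rw [← dropFirst_mul, hOT, dropFirst_obs]
  -- Removing one block row keeps full column rank, since the remaining `2 * n` block rows already
  -- determine the state.
  have hX : IsUnit ((dropLast (obsEst U' t))ᵀ * dropLast (obsEst U' t)).det := by
    refine isUnit_det_gram_of_leftInverse (L := T * leftPinv (P.obs (2 * n))) ?_
    rw [Matrix.mul_assoc, mul_eq_one_comm, Matrix.mul_assoc, hdl, leftPinv_mul hO2]
  have hcont1 : Continuous (dropLast : Matrix (Fin (2 * n + 1) × Fin p) (Fin n) ℝ → _) :=
    continuous_id.matrix_submatrix _ _
  have hcont2 : Continuous (dropFirst : Matrix (Fin (2 * n + 1) × Fin p) (Fin n) ℝ → _) :=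
    continuous_id.matrix_submatrix _ _
  refine ⟨ψ, ⟨leftPinv (dropLast (obsEst U' t)) * dropFirst (obsEst U' t),
    ctrEst t V' * selB (2 * n) m, selC (2 * n + 1) p * obsEst U' t, P.D⟩, hmono,
    ⟨T, hT, ?_, ?_, ?_, rfl⟩, ⟨?_, ?_, ?_, ?_⟩⟩
  · dsimp only
    rw [Matrix.mul_assoc, hdf, ← hdl, Matrix.mul_assoc, ← Matrix.mul_assoc, leftPinv_mul hX,
      Matrix.one_mul]
  · dsimp only
    rw [hRT, Matrix.mul_assoc, ctr_mul_selB P (by omega)]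
  · dsimp only
    rw [Matrix.mul_assoc, hOT, selC_mul_obs]
  · exact tendsto_matrix_mul (tendsto_leftPinv ((hcont1.tendsto _).comp hOb) hX)
      ((hcont2.tendsto _).comp hOa)
  · exact tendsto_matrix_mul hRb tendsto_const_nhds
  · exact tendsto_matrix_mul tendsto_const_nhds hOa
  · exact hD.comp hmono.tendsto_atTop

/-! ### Continuity of the sum of the moduli of the eigenvalues -/

/-- Gershgorin: an eigenvalue lies in a disc whose centre is a diagonal entry and whose radius is
the sum of the other moduli in that row. -/
theorem norm_le_of_mem_roots_charpoly {n : ℕ} {X : Matrix (Fin n) (Fin n) ℂ} {B : ℝ}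
    (hB : ∀ i j, ‖X i j‖ ≤ B) {z : ℂ} (hz : z ∈ X.charpoly.roots) : ‖z‖ ≤ B + n * B := by
  have hroot := Polynomial.isRoot_of_mem_roots hz
  have hz' : Module.End.HasEigenvalue (Matrix.toLin' X) z := by
    rw [Module.End.hasEigenvalue_iff_isRoot_charpoly, Matrix.charpoly_toLin']
    exact hroot
  obtain ⟨k, hk⟩ := eigenvalue_mem_ball hz'
  have h1 : ‖z - X k k‖ ≤ ∑ j ∈ Finset.univ.erase k, ‖X k j‖ := by
    rwa [mem_closedBall_iff_norm] at hk
  have h2 : ∑ j ∈ Finset.univ.erase k, ‖X k j‖ ≤ n * B := by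
    calc _ ≤ ∑ j, ‖X k j‖ :=
          Finset.sum_le_sum_of_subset_of_nonneg (Finset.erase_subset _ _) fun _ _ _ => norm_nonneg _
      _ ≤ ∑ _j : Fin n, B := Finset.sum_le_sum fun j _ => hB k j
      _ = n * B := by simp
  calc ‖z‖ = ‖X k k + (z - X k k)‖ := by rw [add_sub_cancel]
    _ ≤ ‖X k k‖ + ‖z - X k k‖ := norm_add_le _ _
    _ ≤ B + n * B := add_le_add (hB k k) (h1.trans h2)

/-- Numbering the roots, in no particular order, turns the multiset into a vector, to which
compactness in `Fin n → ℂ` applies. -/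
theorem exists_roots_charpoly {n : ℕ} (X : Matrix (Fin n) (Fin n) ℂ) :
    ∃ z : Fin n → ℂ, X.charpoly.roots = Finset.univ.val.map z ∧
      ∀ w, (scalar (Fin n) w - X).det = ∏ i, (w - z i) := by
  have hsplit : X.charpoly.Splits := IsAlgClosed.splits _
  have hcard : X.charpoly.roots.card = n := by
    rw [← hsplit.natDegree_eq_card_roots, charpoly_natDegree_eq_dim, Fintype.card_fin]
  obtain ⟨l, hl⟩ := Quotient.exists_rep X.charpoly.roots
  have hl' : (l : Multiset ℂ) = X.charpoly.roots := hl
  have hlen : l.length = n := by rw [← hcard, ← hl', Multiset.coe_card]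
  subst hlen
  have hr : X.charpoly.roots = Finset.univ.val.map l.get := by
    rw [← hl', Fin.univ_val_map, List.ofFn_get]
  refine ⟨l.get, hr, fun w => ?_⟩
  rw [← eval_charpoly, hsplit.eq_prod_roots_of_monic (charpoly_monic X), hr, Multiset.map_map,
    Polynomial.eval_multiset_prod, Multiset.map_map]
  simp [Finset.prod]

/-- No continuous choice of eigenvalues is needed. The root vectors are bounded, so each subsequence
has a further one along which they converge; the limit vector lists the roots of the limit
polynomial, and the sum of moduli does not depend on their order. -/
theorem tendsto_eigSum {n : ℕ} {X : ℕ → Matrix (Fin n) (Fin n) ℝ} {Y : Matrix (Fin n) (Fin n) ℝ}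
    (hX : Tendsto X atTop (𝓝 Y)) : Tendsto (fun k => eigSum (X k)) atTop (𝓝 (eigSum Y)) := by
  set f : Matrix (Fin n) (Fin n) ℝ → Matrix (Fin n) (Fin n) ℂ := fun M => M.map (algebraMap ℝ ℂ)
    with hf
  have hfc : Continuous f := by
    refine continuous_pi fun i => continuous_pi fun j => ?_
    exact Complex.continuous_ofReal.comp (continuous_id.matrix_elem i j)
  have hsum : ∀ (M : Matrix (Fin n) (Fin n) ℝ) (z : Fin n → ℂ),
      (f M).charpoly.roots = Finset.univ.val.map z → eigSum M = ∑ i, ‖z i‖ := by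
    intro M z hz
    rw [eigSum, hz, Multiset.map_map]
    rfl
  obtain ⟨B, hB⟩ := ((continuous_frob.tendsto Y).comp hX).bddAbove_range
  have hB' : ∀ k i j, ‖f (X k) i j‖ ≤ B := by
    intro k i j
    have : ‖f (X k) i j‖ = |X k i j| := by simp [hf]
    rw [this]
    exact (abs_apply_le_frob _ i j).trans (hB ⟨k, rfl⟩)
  choose z hz hdet using fun k => exists_roots_charpoly (f (X k))
  refine tendsto_of_subseq_tendsto fun ns hns => ?_
  have hmem : ∀ k, z (ns k) ∈ Set.univ.pi fun _ : Fin n => Metric.closedBall (0 : ℂ) (B + n * B) := by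
    intro k i _
    rw [mem_closedBall_zero_iff]
    refine norm_le_of_mem_roots_charpoly (hB' (ns k)) ?_
    rw [hz]
    exact Multiset.mem_map_of_mem _ (Finset.mem_univ_val i)
  obtain ⟨y, -, ms, hms, hy⟩ :=
    (isCompact_univ_pi fun _ : Fin n => isCompact_closedBall (0 : ℂ) (B + n * B)).tendsto_subseq hmem
  refine ⟨ms, ?_⟩
  have hy' : ∀ i, Tendsto (fun k => z (ns (ms k)) i) atTop (𝓝 (y i)) := tendsto_pi_nhds.1 hy
  -- The characteristic polynomials have two expressions, a determinant and a product over the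
  -- roots; both converge pointwise.
  have hlim : ∀ w, (f Y).charpoly.eval w = ∏ i, (w - y i) := by
    intro w
    have h1 : Tendsto (fun k => (scalar (Fin n) w - f (X (ns (ms k)))).det) atTop
        (𝓝 (scalar (Fin n) w - f Y).det) := by
      have hc : Continuous fun M => (scalar (Fin n) w - f M).det := by fun_prop
      exact (hc.tendsto Y).comp (hX.comp (hns.comp hms.tendsto_atTop))
    have h2 : Tendsto (fun k => ∏ i, (w - z (ns (ms k)) i)) atTop (𝓝 (∏ i, (w - y i))) :=
      tendsto_finsetProd _ fun i _ => tendsto_const_nhds.sub (hy' i)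
    rw [eval_charpoly]
    exact tendsto_nhds_unique h1 (h2.congr fun k => (hdet _ w).symm)
  have hchar : (f Y).charpoly =
      ((Finset.univ.val.map y).map fun a => Polynomial.X - Polynomial.C a).prod := by
    refine Polynomial.funext fun w => ?_
    rw [hlim, Multiset.map_map, Polynomial.eval_multiset_prod, Multiset.map_map]
    simp [Finset.prod]
  have hroots : (f Y).charpoly.roots = Finset.univ.val.map y := by
    rw [hchar, Polynomial.roots_multiset_prod_X_sub_C]
  rw [hsum Y y hroots]
  have : Tendsto (fun k => ∑ i, ‖z (ns (ms k)) i‖) atTop (𝓝 (∑ i, ‖y i‖)) :=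
    tendsto_finsetSum _ fun i _ => (hy' i).norm
  exact this.congr fun k => (hsum _ _ (hz _)).symm

/-! ### Limits of the detection criteria -/

theorem tendsto_hankel {m p : ℕ} {h : ℕ → ℕ → ℕ → Matrix (Fin p) (Fin m) ℝ}
    {M : ℕ → ℕ → Matrix (Fin p) (Fin m) ℝ} {q r k : ℕ}
    (hM : ∀ s < q, ∀ t < r,
      Tendsto (fun i => h i (k + s) (k - 1 - t)) atTop (𝓝 (M (k + s) (k - 1 - t)))) :
    Tendsto (fun i => hankel (h i) q r k) atTop (𝓝 (hankel M q r k)) := by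
  refine tendsto_pi_nhds.2 fun x => tendsto_pi_nhds.2 fun y => ?_
  have := hM x.1.val x.1.isLt y.1.val y.1.isLt
  exact tendsto_pi_nhds.1 (tendsto_pi_nhds.1 this x.2) y.2

theorem StateTendsto.ctr {n m p : ℕ} {P : ℕ → DiscreteState n m p} {Q : DiscreteState n m p}
    (h : StateTendsto P Q) (r : ℕ) : Tendsto (fun k => (P k).ctr r) atTop (𝓝 (Q.ctr r)) := by
  refine tendsto_pi_nhds.2 fun i => tendsto_pi_nhds.2 fun y => ?_
  have := tendsto_matrix_mul (tendsto_matrix_pow h.A y.1.val) h.B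
  exact tendsto_pi_nhds.1 (tendsto_pi_nhds.1 this i) y.2

theorem StateTendsto.obs {n m p : ℕ} {P : ℕ → DiscreteState n m p} {Q : DiscreteState n m p}
    (h : StateTendsto P Q) (q : ℕ) : Tendsto (fun k => (P k).obs q) atTop (𝓝 (Q.obs q)) := by
  refine tendsto_pi_nhds.2 fun x => tendsto_pi_nhds.2 fun j => ?_
  have := tendsto_matrix_mul h.C (tendsto_matrix_pow h.A x.1.val)
  exact tendsto_pi_nhds.1 (tendsto_pi_nhds.1 this x.2) j

theorem frob_add_frob_eq_zero_iff {ι κ ι' κ' : Type*} [Fintype ι] [Fintype κ] [Fintype ι']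
    [Fintype κ'] {X : Matrix ι κ ℝ} {Y : Matrix ι' κ' ℝ} : frob X + frob Y = 0 ↔ X = 0 ∧ Y = 0 := by
  rw [add_eq_zero_iff_of_nonneg (frob_nonneg X) (frob_nonneg Y)]
  constructor
  · exact fun h => ⟨eq_zero_of_frob_eq_zero h.1, eq_zero_of_frob_eq_zero h.2⟩
  · rintro ⟨rfl, rfl⟩
    exact ⟨frob_zero, frob_zero⟩

/-- Here `C'` and `D'` are the true matrices at time `ℓ`, possibly of the next discrete state. Since
`Q.ctr = T * P.ctr`, the limit of `Č` is `C' * T⁻¹`, to be compared with `Q.C = P.C * T⁻¹`. -/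
theorem exists_tendsto_forwardCriterion {n m p : ℕ} {h : ℕ → ℕ → ℕ → Matrix (Fin p) (Fin m) ℝ}
    {P Q : DiscreteState n m p} {E : ℕ → DiscreteState n m p} {ℓ : ℕ}
    {C' : Matrix (Fin p) (Fin n) ℝ} {D' : Matrix (Fin p) (Fin m) ℝ} (hP : P.HasMacmillanDegree n)
    (hPQ : Similar P Q) (hE : StateTendsto E Q)
    (hH : Tendsto (fun k => (hankel (h k) 1 (2 * n) ℓ).submatrix (fun a => ((0 : Fin 1), a)) id)
      atTop (𝓝 (C' * P.ctr (2 * n))))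
    (hD : Tendsto (fun k => h k ℓ ℓ) atTop (𝓝 D')) :
    ∃ L, Tendsto (fun k => forwardCriterion (h k) (E k) ℓ) atTop (𝓝 L) ∧ 0 ≤ L ∧
      (L = 0 ↔ C' = P.C ∧ D' = P.D) := by
  obtain ⟨T, hT, hA, hB, hC, hD'⟩ := hPQ
  have hR := DiscreteState.isUnit_det_ctr hP (q := 2 * n) (by omega)
  have hQ : Q.ctr (2 * n) = T * P.ctr (2 * n) := ctr_eq_of_similar hA hB _
  have hPc : P.ctr (2 * n) = T⁻¹ * Q.ctr (2 * n) := by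
    rw [hQ, ← Matrix.mul_assoc, nonsing_inv_mul _ hT, Matrix.one_mul]
  have hRQ : IsUnit (Q.ctr (2 * n) * (Q.ctr (2 * n))ᵀ).det := by
    refine isUnit_det_gram_of_rightInverse (L := rightPinv (P.ctr (2 * n)) * T⁻¹) ?_
    rw [hQ, Matrix.mul_assoc, ← Matrix.mul_assoc (P.ctr _), mul_rightPinv hR, Matrix.one_mul,
      mul_nonsing_inv _ hT]
  refine ⟨frob (C' * P.ctr (2 * n) * rightPinv (Q.ctr (2 * n)) - Q.C) + frob (D' - Q.D), ?_,
    add_nonneg (frob_nonneg _) (frob_nonneg _), ?_⟩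
  · refine Tendsto.add ((continuous_frob.tendsto _).comp (Tendsto.sub ?_ hE.C))
      ((continuous_frob.tendsto _).comp (hD.sub hE.D))
    exact tendsto_matrix_mul hH (tendsto_rightPinv (hE.ctr _) hRQ)
  · rw [frob_add_frob_eq_zero_iff, sub_eq_zero, sub_eq_zero, hD', hPc, Matrix.mul_assoc,
      Matrix.mul_assoc, mul_rightPinv hRQ, Matrix.mul_one, ← hC]
    refine and_congr_left fun _ => ⟨fun h => ?_, fun h => ?_⟩
    · rw [← h, Matrix.mul_assoc, nonsing_inv_mul _ hT, Matrix.mul_one]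
    · rw [h, Matrix.mul_assoc, mul_nonsing_inv _ hT, Matrix.mul_one]

/-- Dually, `Q.obs * T = P.obs` makes `T * B'` the limit of `B̌`, to be compared with `Q.B = T *
P.B`. -/
theorem exists_tendsto_backwardCriterion {n m p : ℕ} {h : ℕ → ℕ → ℕ → Matrix (Fin p) (Fin m) ℝ}
    {P Q : DiscreteState n m p} {E : ℕ → DiscreteState n m p} {ℓ : ℕ}
    {B' : Matrix (Fin n) (Fin m) ℝ} {D' : Matrix (Fin p) (Fin m) ℝ} (hP : P.HasMacmillanDegree n)
    (hPQ : Similar P Q) (hE : StateTendsto E Q)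
    (hH : Tendsto (fun k => (hankel (h k) (2 * n) 1 (ℓ + 1)).submatrix id fun b => ((0 : Fin 1), b))
      atTop (𝓝 (P.obs (2 * n) * B')))
    (hD : Tendsto (fun k => h k ℓ ℓ) atTop (𝓝 D')) :
    ∃ L, Tendsto (fun k => backwardCriterion (h k) (E k) ℓ) atTop (𝓝 L) ∧ 0 ≤ L ∧
      (L = 0 ↔ B' = P.B ∧ D' = P.D) := by
  obtain ⟨T, hT, hA, hB, hC, hD'⟩ := hPQ
  have hO := DiscreteState.isUnit_det_obs hP (q := 2 * n) (by omega)
  have hQ : Q.obs (2 * n) * T = P.obs (2 * n) := obs_mul_eq_of_similar hA hC _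
  have hOQ : IsUnit ((Q.obs (2 * n))ᵀ * Q.obs (2 * n)).det := by
    refine isUnit_det_gram_of_leftInverse (L := T * leftPinv (P.obs (2 * n))) ?_
    rw [Matrix.mul_assoc, mul_eq_one_comm, Matrix.mul_assoc, hQ, leftPinv_mul hO]
  refine ⟨frob (leftPinv (Q.obs (2 * n)) * (P.obs (2 * n) * B') - Q.B) + frob (D' - Q.D), ?_,
    add_nonneg (frob_nonneg _) (frob_nonneg _), ?_⟩
  · refine Tendsto.add ((continuous_frob.tendsto _).comp (Tendsto.sub ?_ hE.B))
      ((continuous_frob.tendsto _).comp (hD.sub hE.D))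
    exact tendsto_matrix_mul (tendsto_leftPinv (hE.obs _) hOQ) hH
  · rw [frob_add_frob_eq_zero_iff, sub_eq_zero, sub_eq_zero, hD', ← hQ, ← Matrix.mul_assoc,
      ← Matrix.mul_assoc, leftPinv_mul hOQ, Matrix.one_mul, hB]
    refine and_congr_left fun _ => ⟨fun h => ?_, fun h => by rw [h]⟩
    have := congrArg (T⁻¹ * ·) h
    simpa [← Matrix.mul_assoc, nonsing_inv_mul _ hT] using this

/-! ### Noise bounds from sequences of counterexamples -/

/-- The same `ε` occurs in hypothesis and conclusion, so one number can serve both as a noise bound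
and as a lower bound for a quantity whose limit is positive. -/
theorem exists_pos_of_sequences {X : Type*} (Q R : ℝ → X → Prop)
    (h : ∀ (ε : ℕ → ℝ) (x : ℕ → X), (∀ k, 0 < ε k) → Tendsto ε atTop (𝓝 0) →
      (∀ k, Q (ε k) (x k)) → ∃ k, R (ε k) (x k)) :
    ∃ ε, 0 < ε ∧ ∀ x, Q ε x → R ε x := by
  by_contra! hcon
  choose x hQ hR using fun k : ℕ => hcon (1 / ((k : ℝ) + 1)) Nat.one_div_pos_of_nat
  obtain ⟨k, hk⟩ := h _ x (fun k => Nat.one_div_pos_of_nat) tendsto_one_div_add_atTop_nhds_zero_nat hQ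
  exact hR k hk

theorem exists_pos_forall_mem {X : Type*} (S : Finset X) (Q : X → ℝ → Prop)
    (hQ : ∀ x ε ε', ε ≤ ε' → Q x ε' → Q x ε) (h : ∀ x ∈ S, ∃ ε, 0 < ε ∧ Q x ε) :
    ∃ ε, 0 < ε ∧ ∀ x ∈ S, Q x ε := by
  classical
  induction S using Finset.induction_on with
  | empty => exact ⟨1, one_pos, fun x hx => absurd hx (Finset.notMem_empty x)⟩
  | insert y S _ ih =>
    obtain ⟨ε, hε, hεQ⟩ := ih fun x hx => h x (Finset.mem_insert_of_mem hx)
    obtain ⟨ε', hε', hεQ'⟩ := h y (Finset.mem_insert_self y S)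
    refine ⟨min ε ε', lt_min hε hε', fun x hx => ?_⟩
    rcases Finset.mem_insert.1 hx with rfl | hx
    · exact hQ _ _ _ (min_le_right _ _) hεQ'
    · exact hQ _ _ _ (min_le_left _ _) (hεQ x hx)

/-- The noise amplitude on the record `1 ≤ ℓ ≤ k ≤ N` is at most `ε`. -/
def NoiseLE {m p : ℕ} (M : ℕ → ℕ → Matrix (Fin p) (Fin m) ℝ) (N : ℕ) (ε : ℝ)
    (h : ℕ → ℕ → Matrix (Fin p) (Fin m) ℝ) : Prop :=
  ∀ k ℓ, 1 ≤ ℓ → ℓ ≤ k → k ≤ N → frob (h k ℓ - M k ℓ) ≤ ε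

theorem NoiseLE.mono {m p : ℕ} {M h : ℕ → ℕ → Matrix (Fin p) (Fin m) ℝ} {N : ℕ} {ε ε' : ℝ}
    (hh : NoiseLE M N ε h) (hε : ε ≤ ε') : NoiseLE M N ε' h :=
  fun k ℓ h1 h2 h3 => (hh k ℓ h1 h2 h3).trans hε

/-- The noise tends to zero on the record `1 ≤ ℓ ≤ k ≤ N`. -/
def RecordTendsto {m p : ℕ} (M : ℕ → ℕ → Matrix (Fin p) (Fin m) ℝ) (N : ℕ)
    (h : ℕ → ℕ → ℕ → Matrix (Fin p) (Fin m) ℝ) : Prop :=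
  ∀ k ℓ, 1 ≤ ℓ → ℓ ≤ k → k ≤ N → Tendsto (fun i => h i k ℓ) atTop (𝓝 (M k ℓ))

theorem RecordTendsto.of_noiseLE {m p : ℕ} {M : ℕ → ℕ → Matrix (Fin p) (Fin m) ℝ} {N : ℕ}
    {h : ℕ → ℕ → ℕ → Matrix (Fin p) (Fin m) ℝ} {ε : ℕ → ℝ} (hε : Tendsto ε atTop (𝓝 0))
    (hh : ∀ i, NoiseLE M N (ε i) (h i)) : RecordTendsto M N h :=
  fun k ℓ h1 h2 h3 =>
    tendsto_of_frob_sub_le hε tendsto_const_nhds fun i => hh i k ℓ h1 h2 h3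

/-- The hypotheses on the singular value decompositions at the times `γ` and `γ + 1`. -/
def ConsistentSVD {n m p : ℕ} (h : ℕ → ℕ → Matrix (Fin p) (Fin m) ℝ)
    (U : ℕ → Matrix (Fin (2 * n + 1) × Fin p) (Fin n) ℝ) (s : ℕ → Fin n → ℝ)
    (V : ℕ → Matrix (Fin (2 * n) × Fin m) (Fin n) ℝ) (γ : ℕ) (ε : ℝ) : Prop :=
  IsTruncatedSVD (hankel h (2 * n + 1) (2 * n) γ) (U γ) (s γ) (V γ) ∧
  IsTruncatedSVD (hankel h (2 * n + 1) (2 * n) (γ + 1)) (U (γ + 1)) (s (γ + 1)) (V (γ + 1)) ∧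
  frob (U (γ + 1) - U γ) ≤ ε

theorem ConsistentSVD.mono {n m p : ℕ} {h : ℕ → ℕ → Matrix (Fin p) (Fin m) ℝ}
    {U : ℕ → Matrix (Fin (2 * n + 1) × Fin p) (Fin n) ℝ} {s : ℕ → Fin n → ℝ}
    {V : ℕ → Matrix (Fin (2 * n) × Fin m) (Fin n) ℝ} {γ : ℕ} {ε ε' : ℝ}
    (hh : ConsistentSVD h U s V γ ε) (hε : ε ≤ ε') : ConsistentSVD h U s V γ ε' :=
  ⟨hh.1, hh.2.1, hh.2.2.trans hε⟩

/-- The Hankel matrices of the record `M` at the times `γ` and `γ + 1`, which lie inside the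
observation window, are those of the time-invariant system `P`. -/
structure IsLocallyInvariant {n m p : ℕ} (M : ℕ → ℕ → Matrix (Fin p) (Fin m) ℝ) (N : ℕ)
    (P : DiscreteState n m p) (γ : ℕ) : Prop where
  first_le : 2 * n + 1 ≤ γ
  le_last : γ + 4 * n ≤ N
  hankel_eq : hankel M (2 * n + 1) (2 * n) γ = P.obs (2 * n + 1) * P.ctr (2 * n)
  hankel_succ_eq : hankel M (2 * n + 1) (2 * n) (γ + 1) = P.obs (2 * n + 1) * P.ctr (2 * n)
  diag_eq : M γ γ = P.D

/-- A property of the record and of the estimate at time `γ` holds for all small noise as soon as it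
holds along every sequence of records with vanishing noise and every convergent sequence of
estimates. -/
theorem exists_noise_bound {n m p : ℕ} (hn : 0 < n) {M : ℕ → ℕ → Matrix (Fin p) (Fin m) ℝ} {N : ℕ}
    {P : DiscreteState n m p} (hP : P.HasMacmillanDegree n) {γ : ℕ}
    (hγ : IsLocallyInvariant M N P γ)
    (R : ℝ → (ℕ → ℕ → Matrix (Fin p) (Fin m) ℝ) → DiscreteState n m p → Prop)
    (hR : ∀ (ε : ℕ → ℝ) (h : ℕ → ℕ → ℕ → Matrix (Fin p) (Fin m) ℝ) (E : ℕ → DiscreteState n m p)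
      (Q : DiscreteState n m p), Tendsto ε atTop (𝓝 0) → RecordTendsto M N h → Similar P Q →
      StateTendsto E Q → ∃ k, R (ε k) (h k) (E k)) :
    ∃ ε₀, 0 < ε₀ ∧ ∀ h U s V, NoiseLE M N ε₀ h → ConsistentSVD h U s V γ ε₀ →
      R ε₀ h (realize h U s V γ) := by
  obtain ⟨ε₀, hε₀, hall⟩ := exists_pos_of_sequences
    (X := (ℕ → ℕ → Matrix (Fin p) (Fin m) ℝ) × (ℕ → Matrix (Fin (2 * n + 1) × Fin p) (Fin n) ℝ) ×
      (ℕ → Fin n → ℝ) × (ℕ → Matrix (Fin (2 * n) × Fin m) (Fin n) ℝ))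
    (fun ε x => NoiseLE M N ε x.1 ∧ ConsistentSVD x.1 x.2.1 x.2.2.1 x.2.2.2 γ ε)
    (fun ε x => R ε x.1 (realize x.1 x.2.1 x.2.2.1 x.2.2.2 γ)) (by
      intro ε x _ hε hx
      have hrec := RecordTendsto.of_noiseLE hε fun k => (hx k).1
      have h1 := hγ.first_le
      have h2 := hγ.le_last
      have hH0 : Tendsto (fun k => hankel (x k).1 (2 * n + 1) (2 * n) γ) atTop
          (𝓝 (P.obs (2 * n + 1) * P.ctr (2 * n))) := by
        rw [← hγ.hankel_eq]
        exact tendsto_hankel fun s _ t _ => hrec _ _ (by omega) (by omega) (by omega)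
      have hH1 : Tendsto (fun k => hankel (x k).1 (2 * n + 1) (2 * n) (γ + 1)) atTop
          (𝓝 (P.obs (2 * n + 1) * P.ctr (2 * n))) := by
        rw [← hγ.hankel_succ_eq]
        exact tendsto_hankel fun s _ t _ => hrec _ _ (by omega) (by omega) (by omega)
      have hD : Tendsto (fun k => (x k).1 γ γ) atTop (𝓝 P.D) := by
        rw [← hγ.diag_eq]
        exact hrec _ _ (by omega) le_rfl (by omega)
      obtain ⟨ψ, Q, hψ, hPQ, hE⟩ := exists_subseq_realize hn hP (h := fun k => (x k).1)
        (U := fun k => (x k).2.1) (s := fun k => (x k).2.2.1) (V := fun k => (x k).2.2.2)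
        (fun k => (hx k).2.1) (fun k => (hx k).2.2.1) hH0 hH1 hD hε fun k => (hx k).2.2.2
      -- One good index suffices to refute a sequence of counterexamples, so passing to a
      -- subsequence costs nothing.
      obtain ⟨k, hk⟩ := hR (fun k => ε (ψ k)) (fun k => (x (ψ k)).1) _ Q
        (hε.comp hψ.tendsto_atTop)
        (fun k ℓ h1 h2 h3 => (hrec k ℓ h1 h2 h3).comp hψ.tendsto_atTop) hPQ hE
      exact ⟨ψ k, hk⟩)
  exact ⟨ε₀, hε₀, fun h U s V hN hS => hall (h, U, s, V) ⟨hN, hS⟩⟩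

/-! ### Markov parameters of the switched system -/

theorem transition_eq_pow {n : ℕ} {A : ℕ → Matrix (Fin n) (Fin n) ℝ}
    {X : Matrix (Fin n) (Fin n) ℝ} {ℓ j : ℕ} (h : ∀ t, ℓ ≤ t → t < ℓ + j → A t = X) :
    transition A ℓ j = X ^ j := by
  induction j with
  | zero => simp [transition]
  | succ j ih =>
    rw [transition, ih fun t h1 h2 => h t h1 (by omega), h _ (by omega) (by omega), pow_succ']

theorem transition_add {n : ℕ} (A : ℕ → Matrix (Fin n) (Fin n) ℝ) (ℓ a b : ℕ) :
    transition A ℓ (a + b) = transition A (ℓ + a) b * transition A ℓ a := by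
  induction b with
  | zero => simp [transition]
  | succ b ih => rw [← add_assoc, transition, ih, transition, Matrix.mul_assoc, add_assoc]

theorem markov_self {n m p σ : ℕ} (mode : Fin σ → DiscreteState n m p) (φ : ℕ → Fin σ) (k : ℕ) :
    markov mode φ k k = (mode (φ k)).D := by
  simp [markov]

theorem IsSegmentation.lt {σ : ℕ} {φ : ℕ → Fin σ} {N last : ℕ} {κ : ℕ → ℕ}
    (hseg : IsSegmentation φ N last κ) {i j : ℕ} (hij : i < j) (hj : j ≤ last + 1) : κ i < κ j := by
  induction j, hij using Nat.le_induction with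
  | base => exact hseg.lt_next i (by omega)
  | succ j hij ih => exact (ih (by omega)).trans (hseg.lt_next j (by omega))

theorem IsSegmentation.le {σ : ℕ} {φ : ℕ → Fin σ} {N last : ℕ} {κ : ℕ → ℕ}
    (hseg : IsSegmentation φ N last κ) {i j : ℕ} (hij : i ≤ j) (hj : j ≤ last + 1) : κ i ≤ κ j := by
  rcases hij.eq_or_lt with rfl | hij
  · exact le_rfl
  · exact (hseg.lt hij hj).le

theorem IsSegmentation.one_le {σ : ℕ} {φ : ℕ → Fin σ} {N last : ℕ} {κ : ℕ → ℕ}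
    (hseg : IsSegmentation φ N last κ) {i : ℕ} (hi : i ≤ last + 1) : 1 ≤ κ i :=
  hseg.first_eq ▸ hseg.le (Nat.zero_le i) hi

theorem IsSegmentation.le_end {σ : ℕ} {φ : ℕ → Fin σ} {N last : ℕ} {κ : ℕ → ℕ}
    (hseg : IsSegmentation φ N last κ) {i : ℕ} (hi : i ≤ last) : κ i ≤ N := by
  have := hseg.lt (i := i) (j := last + 1) (by omega) le_rfl
  have := hseg.end_eq
  omega

theorem IsSegmentation.exists_mem {σ : ℕ} {φ : ℕ → Fin σ} {N last : ℕ} {κ : ℕ → ℕ}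
    (hseg : IsSegmentation φ N last κ) {t : ℕ} (h1 : 1 ≤ t) (hN : t ≤ N) :
    ∃ i ≤ last, κ i ≤ t ∧ t < κ (i + 1) := by
  have key : ∀ j, t < κ j → ∃ i < j, κ i ≤ t ∧ t < κ (i + 1) := by
    intro j
    induction j with
    | zero => intro h; rw [hseg.first_eq] at h; omega
    | succ j ih =>
      intro h
      by_cases hj : t < κ j
      · obtain ⟨i, hi, h'⟩ := ih hj
        exact ⟨i, by omega, h'⟩
      · exact ⟨j, by omega, by omega, h⟩
  obtain ⟨i, hi, h⟩ := key (last + 1) (by rw [hseg.end_eq]; omega)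
  exact ⟨i, by omega, h⟩

theorem IsSegmentation.index_unique {σ : ℕ} {φ : ℕ → Fin σ} {N last : ℕ} {κ : ℕ → ℕ}
    (hseg : IsSegmentation φ N last κ) {i j t : ℕ} (hi : i ≤ last) (hj : j ≤ last)
    (h1 : κ i ≤ t) (h2 : t < κ (i + 1)) (h3 : κ j ≤ t) (h4 : t < κ (j + 1)) : i = j := by
  rcases lt_trichotomy i j with h | h | h
  · have := hseg.le (i := i + 1) (j := j) h (by omega)
    omega
  · exact h
  · have := hseg.le (i := j + 1) (j := i) h (by omega)
    omega

theorem IsSegmentation.mode_ne {σ : ℕ} {φ : ℕ → Fin σ} {N last : ℕ} {κ : ℕ → ℕ}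
    (hseg : IsSegmentation φ N last κ) {i : ℕ} (hi : i < last) : φ (κ i) ≠ φ (κ (i + 1)) := by
  have h1 := hseg.lt_next i hi.le
  rw [← hseg.const i hi.le (κ (i + 1) - 1) (by omega) (by omega)]
  exact hseg.switch i hi

/-- Only the times `ℓ + 1, …, k - 1` enter the transition product. So `ℓ` may be the time just
before the segment and `k` the time just after it, which is why `C` and `B` are taken at `k` and
`ℓ`. Switch detection rests on these two extra times. -/
theorem markov_eq_pow {n m p σ : ℕ} {mode : Fin σ → DiscreteState n m p} {φ : ℕ → Fin σ}
    {N last : ℕ} {κ : ℕ → ℕ} (hseg : IsSegmentation φ N last κ) {i k ℓ : ℕ} (hi : i ≤ last)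
    (h1 : κ i ≤ ℓ + 1) (h2 : ℓ < k) (h3 : k ≤ κ (i + 1)) :
    markov mode φ k ℓ =
      (mode (φ k)).C * (mode (φ (κ i))).A ^ (k - (ℓ + 1)) * (mode (φ ℓ)).B := by
  rw [markov, if_pos h2, transition_eq_pow (X := (mode (φ (κ i))).A)]
  intro t ht1 ht2
  rw [hseg.const i hi t (by omega) (by omega)]

theorem markov_eq_of_switch {n m p σ : ℕ} {mode : Fin σ → DiscreteState n m p} {φ : ℕ → Fin σ}
    {N last : ℕ} {κ : ℕ → ℕ} (hseg : IsSegmentation φ N last κ) {i k ℓ : ℕ} (hi : i < last)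
    (h1 : κ i ≤ ℓ) (h2 : ℓ < κ (i + 1)) (h3 : κ (i + 1) ≤ k) (h4 : k < κ (i + 1 + 1)) :
    markov mode φ k ℓ =
      ((mode (φ (κ (i + 1)))).C * (mode (φ (κ (i + 1)))).A ^ (k - κ (i + 1))) *
        ((mode (φ (κ i))).A ^ (κ (i + 1) - (ℓ + 1)) * (mode (φ (κ i))).B) := by
  have hk : k - (ℓ + 1) = (κ (i + 1) - (ℓ + 1)) + (k - κ (i + 1)) := by omega
  rw [markov, if_pos (by omega), hk, transition_add,
    transition_eq_pow (X := (mode (φ (κ i))).A) (ℓ := ℓ + 1),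
    transition_eq_pow (X := (mode (φ (κ (i + 1)))).A), hseg.const i hi.le ℓ h1 h2,
    hseg.const (i + 1) hi k h3 h4]
  · simp only [Matrix.mul_assoc]
  · intro t ht1 ht2
    rw [hseg.const (i + 1) hi t (by omega) (by omega)]
  · intro t ht1 ht2
    rw [hseg.const i hi.le t (by omega) (by omega)]

theorem hankel_markov_eq {n m p σ : ℕ} {mode : Fin σ → DiscreteState n m p} {φ : ℕ → Fin σ}
    {N last : ℕ} {κ : ℕ → ℕ} (hseg : IsSegmentation φ N last κ) {i k : ℕ} (hi : i ≤ last)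
    (h1 : κ i + 2 * n ≤ k) (h2 : k + 2 * n < κ (i + 1)) :
    hankel (markov mode φ) (2 * n + 1) (2 * n) k =
      (mode (φ (κ i))).obs (2 * n + 1) * (mode (φ (κ i))).ctr (2 * n) := by
  rw [DiscreteState.obs_mul_ctr]
  ext ⟨s, a⟩ ⟨t, b⟩
  have hs := s.isLt
  have ht := t.isLt
  have he : k + s.val - (k - 1 - t.val + 1) = s.val + t.val := by omega
  simp only [hankel, of_apply]
  rw [markov_eq_pow hseg hi (by omega) (by omega) (by omega), he,
    hseg.const i hi (k + s.val) (by omega) (by omega),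
    hseg.const i hi (k - 1 - t.val) (by omega) (by omega)]

theorem hankel_row_markov_eq {n m p σ : ℕ} {mode : Fin σ → DiscreteState n m p} {φ : ℕ → Fin σ}
    {N last : ℕ} {κ : ℕ → ℕ} (hseg : IsSegmentation φ N last κ) {i ℓ : ℕ} (hi : i ≤ last)
    (h1 : κ i + 2 * n ≤ ℓ) (h2 : ℓ ≤ κ (i + 1)) :
    (hankel (markov mode φ) 1 (2 * n) ℓ).submatrix (fun a => ((0 : Fin 1), a)) id =
      (mode (φ ℓ)).C * (mode (φ (κ i))).ctr (2 * n) := by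
  ext a ⟨t, b⟩
  have ht := t.isLt
  have he : ℓ + 0 - (ℓ - 1 - t.val + 1) = t.val := by omega
  simp only [hankel, of_apply, submatrix_apply, id, Fin.val_zero]
  rw [markov_eq_pow hseg hi (by omega) (by omega) (by omega), he,
    hseg.const i hi (ℓ - 1 - t.val) (by omega) (by omega), Matrix.mul_assoc]
  rfl

theorem hankel_col_markov_eq {n m p σ : ℕ} {mode : Fin σ → DiscreteState n m p} {φ : ℕ → Fin σ}
    {N last : ℕ} {κ : ℕ → ℕ} (hseg : IsSegmentation φ N last κ) {i ℓ : ℕ} (hi : i ≤ last)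
    (h1 : κ i ≤ ℓ + 1) (h2 : ℓ + 2 * n < κ (i + 1)) :
    (hankel (markov mode φ) (2 * n) 1 (ℓ + 1)).submatrix id (fun b => ((0 : Fin 1), b)) =
      (mode (φ (κ i))).obs (2 * n) * (mode (φ ℓ)).B := by
  ext ⟨s, a⟩ b
  have hs := s.isLt
  have he : ℓ + 1 + s.val - (ℓ + 1) = s.val := by omega
  simp only [hankel, of_apply, submatrix_apply, id, Fin.val_zero, Nat.add_sub_cancel, Nat.sub_zero]
  rw [markov_eq_pow hseg hi (by omega) (by omega) (by omega), he,
    hseg.const i hi (ℓ + 1 + s.val) (by omega) (by omega)]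
  rfl

/-! ### The exact quiet times -/

/-- The times of the observation window at which the Hankel matrix of `M` does not change. -/
def constantSet {m p : ℕ} (n N : ℕ) (M : ℕ → ℕ → Matrix (Fin p) (Fin m) ℝ) : Set ℕ :=
  {k | kFirst n ≤ k ∧ k ≤ kLast n N ∧
    hankel M (2 * n + 1) (2 * n) (k + 1) = hankel M (2 * n + 1) (2 * n) k}

/-- Off the constant set the exact differences are positive, which bounds the noisy ones below by a
`τ₀` chosen before `εZ`; on it the noisy differences tend to zero, so they drop below `εZ`. -/
theorem exists_quietSet_eq {m p : ℕ} (n N : ℕ) (M : ℕ → ℕ → Matrix (Fin p) (Fin m) ℝ) :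
    ∃ τ₀, 0 < τ₀ ∧ ∀ εZ, 0 < εZ → εZ ≤ τ₀ → ∃ ε₀, 0 < ε₀ ∧ ∀ h, NoiseLE M N ε₀ h →
      quietSet n N h εZ = constantSet n N M := by
  have hlim : ∀ (h : ℕ → ℕ → ℕ → Matrix (Fin p) (Fin m) ℝ), RecordTendsto M N h → ∀ k,
      kFirst n ≤ k → k ≤ kLast n N →
      Tendsto (fun j => frob (hankel (h j) (2 * n + 1) (2 * n) (k + 1) -
        hankel (h j) (2 * n + 1) (2 * n) k)) atTop
        (𝓝 (frob (hankel M (2 * n + 1) (2 * n) (k + 1) - hankel M (2 * n + 1) (2 * n) k))) := by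
    intro h hh k h1 h2
    rw [kFirst] at h1
    rw [kLast] at h2
    refine (continuous_frob.tendsto _).comp (Tendsto.sub ?_ ?_)
    · exact tendsto_hankel fun s _ t _ => hh _ _ (by omega) (by omega) (by omega)
    · exact tendsto_hankel fun s _ t _ => hh _ _ (by omega) (by omega) (by omega)
  obtain ⟨τ₀, hτ₀, hgap⟩ := exists_pos_forall_mem (Finset.range (kLast n N + 1))
    (fun k τ => kFirst n ≤ k → k ≤ kLast n N → k ∉ constantSet n N M → ∀ h, NoiseLE M N τ h →
      τ < frob (hankel h (2 * n + 1) (2 * n) (k + 1) - hankel h (2 * n + 1) (2 * n) k))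
    (fun k ε ε' hε hQ h1 h2 h3 h hh => hε.trans_lt (hQ h1 h2 h3 h (hh.mono hε))) (by
      intro k _
      by_cases hk : kFirst n ≤ k ∧ k ≤ kLast n N ∧ k ∉ constantSet n N M
      · obtain ⟨h1, h2, h3⟩ := hk
        obtain ⟨τ, hτ, hall⟩ := exists_pos_of_sequences (NoiseLE M N)
          (fun τ h => τ < frob (hankel h (2 * n + 1) (2 * n) (k + 1) -
            hankel h (2 * n + 1) (2 * n) k)) (by
            intro ε x _ hε hx
            have hpos : 0 < frob (hankel M (2 * n + 1) (2 * n) (k + 1) -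
                hankel M (2 * n + 1) (2 * n) k) := by
              refine lt_of_le_of_ne (frob_nonneg _) fun h0 => h3 ⟨h1, h2, ?_⟩
              exact sub_eq_zero.1 (eq_zero_of_frob_eq_zero h0.symm)
            exact (hε.eventually_lt (hlim x (RecordTendsto.of_noiseLE hε hx) k h1 h2) hpos).exists)
        exact ⟨τ, hτ, fun _ _ _ => hall⟩
      · exact ⟨1, one_pos, fun h1 h2 h3 => absurd ⟨h1, h2, h3⟩ hk⟩)
  refine ⟨τ₀, hτ₀, fun εZ hZ hZτ => ?_⟩
  obtain ⟨ε₀, hε₀, hsmall⟩ := exists_pos_forall_mem (Finset.range (kLast n N + 1))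
    (fun k ε => k ∈ constantSet n N M → ∀ h, NoiseLE M N ε h →
      frob (hankel h (2 * n + 1) (2 * n) (k + 1) - hankel h (2 * n + 1) (2 * n) k) ≤ εZ)
    (fun k ε ε' hε hQ h1 h hh => hQ h1 h (hh.mono hε)) (by
      intro k _
      by_cases hk : k ∈ constantSet n N M
      · obtain ⟨ε, hε, hall⟩ := exists_pos_of_sequences (NoiseLE M N)
          (fun _ h => frob (hankel h (2 * n + 1) (2 * n) (k + 1) -
            hankel h (2 * n + 1) (2 * n) k) ≤ εZ) (by
            intro ε x _ hε hx
            have hl := hlim x (RecordTendsto.of_noiseLE hε hx) k hk.1 hk.2.1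
            rw [hk.2.2, sub_self, frob_zero] at hl
            exact (hl.eventually_le_const hZ).exists)
        exact ⟨ε, hε, fun _ => hall⟩
      · exact ⟨1, one_pos, fun h1 => absurd h1 hk⟩)
  -- The lower bound `τ₀` was itself obtained for noise of amplitude at most `τ₀`.
  refine ⟨min ε₀ τ₀, lt_min hε₀ hτ₀, fun h hh => ?_⟩
  ext k
  constructor
  · rintro ⟨h1, h2, h3⟩
    by_contra hk
    have := hgap k (Finset.mem_range.2 (by omega)) h1 h2 hk h (hh.mono (min_le_right _ _))
    linarith
  · intro hk
    exact ⟨hk.1, hk.2.1, hsmall k (Finset.mem_range.2 (Nat.lt_succ_of_le hk.2.1)) hk h (hh.mono (min_le_left _ _))⟩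

/-- Last time before a switch such that the Hankel matrix at it and at the next time are not affected
by the switch and lie in the window. -/
def steadyRight (n N : ℕ) (κ : ℕ → ℕ) (i : ℕ) : ℕ := min (κ (i + 1) - 2 * n - 2) (N - 4 * n)

/-- Inequalities between the ends of a long segment, of its core, and of the times `κ i + 2 n` to
`steadyRight` at which the Hankel matrix is certain not to change. -/
structure LongBounds (n N last : ℕ) (κ : ℕ → ℕ) (i : ℕ) : Prop where
  le_last : i ≤ last
  one_le : 1 ≤ κ i
  end_le : κ (i + 1) ≤ N + 1
  length : κ i + 6 * n + 1 ≤ κ (i + 1)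
  left_le_right : κ i + 2 * n ≤ steadyRight n N κ i
  le_coreLeft : κ i + 2 * n ≤ coreLeft n κ i
  coreRight_le : coreRight n N last κ i ≤ steadyRight n N κ i
  coreLeft_le : coreLeft n κ i ≤ steadyRight n N κ i + 1
  le_coreRight : κ i + 2 * n ≤ coreRight n N last κ i + 1
  right_le : steadyRight n N κ i + 2 * n + 2 ≤ κ (i + 1)
  right_le_window : steadyRight n N κ i + 4 * n ≤ N

theorem LongSegment.bounds {σ : ℕ} {φ : ℕ → Fin σ} {n N last : ℕ} {κ : ℕ → ℕ} (hn : 0 < n)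
    (hseg : IsSegmentation φ N last κ) {i : ℕ} (hi : LongSegment n N last κ i) :
    LongBounds n N last κ i := by
  have hle : i ≤ last := by rcases hi with h | h | h <;> omega
  have h1 := hseg.one_le (i := i) (by omega)
  have h2 := hseg.le_end hle
  have h3 : i < last → κ (i + 1) ≤ N := fun h => hseg.le_end h
  have h4 : i = last → κ (i + 1) = N + 1 := by rintro rfl; exact hseg.end_eq
  have h5 : i = 0 → κ i = 1 := by rintro rfl; exact hseg.first_eq
  have hle' : κ (i + 1) ≤ N + 1 := by
    rcases hle.lt_or_eq with h | h
    · have := h3 h; omega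
    · have := h4 h; omega
  unfold LongSegment dwell at hi
  rcases hi with ⟨rfl, h⟩ | ⟨hl, rfl, h⟩ | ⟨hl, h0, h⟩
  · have h4 := h4 rfl
    rw [if_pos rfl] at h
    constructor <;> (try simp only [steadyRight, coreLeft, coreRight, kFirst, kLast, if_true]) <;>
      (try split_ifs) <;> omega
  · have h3 := h3 hl
    have h5 := h5 rfl
    rw [if_neg hl.ne] at h
    constructor <;> (try simp only [steadyRight, coreLeft, coreRight, kFirst, kLast, if_neg hl.ne,
      if_true]) <;> omega
  · have h3 := h3 hl
    rw [if_neg hl.ne] at h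
    constructor <;> (try simp only [steadyRight, coreLeft, coreRight, kFirst, kLast, if_neg hl.ne,
      if_neg h0.ne']) <;> omega

theorem steady_subset {n m p σ : ℕ} {mode : Fin σ → DiscreteState n m p} {φ : ℕ → Fin σ}
    {N last : ℕ} {κ : ℕ → ℕ} (hseg : IsSegmentation φ N last κ) {i : ℕ}
    (hb : LongBounds n N last κ i) : Set.Icc (κ i + 2 * n) (steadyRight n N κ i) ⊆
      constantSet n N (markov mode φ) ∩ Set.Ico (κ i) (κ (i + 1)) := by
  intro k hk
  have h1 := hk.1
  have h2 := hk.2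
  obtain ⟨a1, a2, a3, a4, a5, a6, a7, a8, a9, a10, a11⟩ := hb
  refine ⟨⟨?_, ?_, ?_⟩, ?_, ?_⟩
  · rw [kFirst]; omega
  · rw [kLast]; omega
  · rw [hankel_markov_eq hseg a1 (by omega) (by omega),
      hankel_markov_eq hseg a1 (by omega) (by omega)]
  · omega
  · omega

/-- The steady interval covers the core; extending it as far as possible to each side gives the
largest interval. -/
theorem exists_isSegmentInterval {n N last : ℕ} {κ : ℕ → ℕ} {Z : Set ℕ} {i : ℕ}
    (hb : LongBounds n N last κ i)
    (hZ : Set.Icc (κ i + 2 * n) (steadyRight n N κ i) ⊆ Z ∩ Set.Ico (κ i) (κ (i + 1))) :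
    ∃ a b, IsSegmentInterval n N last κ Z i a b := by
  obtain ⟨a1, a2, a3, a4, a5, a6, a7, a8, a9, a10, a11⟩ := hb
  set W := Z ∩ Set.Ico (κ i) (κ (i + 1)) with hW
  set cl := κ i + 2 * n with hcl
  set cr := steadyRight n N κ i with hcr
  set SA := {x | Set.Icc x cr ⊆ W} with hSA
  set SB := {y | Set.Icc cl y ⊆ W} with hSB
  have hclA : cl ∈ SA := hZ
  have hcrB : cr ∈ SB := hZ
  have hbdd : BddAbove SB := by
    refine ⟨cl + κ (i + 1), fun y hy => ?_⟩
    by_contra! hlt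
    have := (hy (show y ∈ Set.Icc cl y from ⟨by omega, le_rfl⟩)).2.2
    omega
  have hA : sInf SA ∈ SA := Nat.sInf_mem ⟨cl, hclA⟩
  have hB : sSup SB ∈ SB := Nat.sSup_mem ⟨cr, hcrB⟩ hbdd
  have hAle : sInf SA ≤ cl := Nat.sInf_le hclA
  have hBle : cr ≤ sSup SB := le_csSup hbdd hcrB
  refine ⟨sInf SA, sSup SB, hAle.trans a6, a7.trans hBle, by omega, ?_, ?_⟩
  · intro x hx
    rcases le_total x cr with h | h
    · exact hA ⟨hx.1, h⟩
    · exact hB ⟨by omega, hx.2⟩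
  -- A competitor covering the core meets the steady interval or is adjacent to it; adjacency is
  -- what the `+ 1` in `coreLeft_le` and `le_coreRight` allows. The union is then still an interval.
  · intro a' b' ha' hb' hsub x hx
    have hx1 := hx.1
    have hx2 := hx.2
    constructor
    · refine (Nat.sInf_le (show a' ∈ SA from ?_)).trans hx.1
      intro y hy
      rcases le_total y b' with h | h
      · exact hsub ⟨hy.1, h⟩
      · rcases h.eq_or_lt with rfl | h
        · exact hsub ⟨hy.1, le_rfl⟩
        · exact hZ ⟨by omega, hy.2⟩
    · refine hx.2.trans (le_csSup hbdd (show b' ∈ SB from ?_))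
      intro y hy
      rcases le_or_gt a' y with h | h
      · exact hsub ⟨h, hy.2⟩
      · exact hZ ⟨hy.1, by omega⟩

theorem IsSegmentInterval.steady_le {n N last : ℕ} {κ : ℕ → ℕ} {Z : Set ℕ} {i a b : ℕ}
    (h : IsSegmentInterval n N last κ Z i a b) (hb : LongBounds n N last κ i)
    (hZ : Set.Icc (κ i + 2 * n) (steadyRight n N κ i) ⊆ Z ∩ Set.Ico (κ i) (κ (i + 1))) :
    a ≤ κ i + 2 * n ∧ steadyRight n N κ i ≤ b := by
  have hsub := h.maximal _ _ hb.le_coreLeft hb.coreRight_le hZ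
  exact (Set.Icc_subset_Icc_iff hb.left_le_right).1 hsub

theorem hankel_eq_of_Icc_subset {n m p N : ℕ} {M : ℕ → ℕ → Matrix (Fin p) (Fin m) ℝ} {a b : ℕ}
    (h : Set.Icc a b ⊆ constantSet n N M) {k : ℕ} (h1 : a ≤ k) (h2 : k ≤ b + 1) :
    hankel M (2 * n + 1) (2 * n) k = hankel M (2 * n + 1) (2 * n) a := by
  induction k, h1 using Nat.le_induction with
  | base => rfl
  | succ k hk ih => rw [(h ⟨hk, by omega⟩).2.2, ih (by omega)]

/-- `[a, b]` may contain times whose Hankel matrix reaches across a switch. Constancy along the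
interval still identifies that matrix with the one at a steady time. -/
theorem IsSegmentInterval.isLocallyInvariant {n m p σ : ℕ} {mode : Fin σ → DiscreteState n m p}
    {φ : ℕ → Fin σ} {N last : ℕ} {κ : ℕ → ℕ} (hn : 0 < n) (hseg : IsSegmentation φ N last κ)
    {i a b γ : ℕ}
    (h : IsSegmentInterval n N last κ (constantSet n N (markov mode φ)) i a b)
    (hb : LongBounds n N last κ i) (h1 : a ≤ γ) (h2 : γ ≤ b) :
    IsLocallyInvariant (markov mode φ) N (mode (φ (κ i))) γ := by
  obtain ⟨h3, h4⟩ := h.steady_le hb (steady_subset hseg hb)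
  have hsub : Set.Icc a b ⊆ constantSet n N (markov mode φ) := fun x hx => (h.subset hx).1
  have hγ := h.subset ⟨h1, h2⟩
  have hk1 : 2 * n + 1 ≤ γ := hγ.1.1
  have hk2 : γ ≤ N - 4 * n := hγ.1.2.1
  have h5 := hb.left_le_right
  have h6 := hb.right_le
  have hH : hankel (markov mode φ) (2 * n + 1) (2 * n) a =
      (mode (φ (κ i))).obs (2 * n + 1) * (mode (φ (κ i))).ctr (2 * n) := by
    rw [← hankel_markov_eq hseg hb.le_last le_rfl (by omega)]
    exact (hankel_eq_of_Icc_subset hsub h3 (by omega)).symm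
  refine ⟨hk1, by omega, ?_, ?_, ?_⟩
  · rw [← hH]
    exact hankel_eq_of_Icc_subset hsub h1 (by omega)
  · rw [← hH]
    exact hankel_eq_of_Icc_subset hsub (by omega) (by omega)
  · rw [markov_self, hseg.const i hb.le_last γ hγ.2.1 hγ.2.2]

/-- Equal Hankel matrices just before and at the switch give `O₂ A₂ R₁ = O₂ A₁ R₁`, where `O₂`
belongs to the new state and `R₁` to the old. Cancelling the full-rank factors yields `A₂ = A₁`,
against separation by the feature. -/
theorem switch_notMem_constantSet {n m p σ : ℕ} {mode : Fin σ → DiscreteState n m p}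
    {φ : ℕ → Fin σ} {N last : ℕ} {κ : ℕ → ℕ} (hseg : IsSegmentation φ N last κ)
    (hmin : StableMinimal mode) (huni : Unimodal mode φ N) {i : ℕ} (hi : i < last)
    (h1 : κ i + 2 * n + 1 ≤ κ (i + 1)) (h2 : κ (i + 1) + 2 * n + 1 ≤ κ (i + 1 + 1)) :
    κ (i + 1) - 1 ∉ constantSet n N (markov mode φ) := by
  rintro ⟨-, -, hH⟩
  have h0 := hseg.one_le (i := i) (by omega)
  have hO := DiscreteState.isUnit_det_obs (hmin (φ (κ (i + 1)))).2 (q := 2 * n) (by omega)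
  have hR := DiscreteState.isUnit_det_ctr (hmin (φ (κ i))).2 (q := 2 * n) (by omega)
  have key : (mode (φ (κ (i + 1)))).obs (2 * n) *
        ((mode (φ (κ (i + 1)))).A * (mode (φ (κ i))).ctr (2 * n)) =
      (mode (φ (κ (i + 1)))).obs (2 * n) *
        ((mode (φ (κ i))).A * (mode (φ (κ i))).ctr (2 * n)) := by
    ext ⟨s, a⟩ ⟨t, b⟩
    have hs := s.isLt
    have ht := t.isLt
    -- Without the first block row, every entry of both matrices has its output time at or after the
    -- switch and its input time before it.
    have he := congrFun (congrFun hH (s.succ, a)) (t, b)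
    simp only [hankel, of_apply, Fin.val_succ] at he
    rw [markov_eq_of_switch hseg hi (by omega) (by omega) (by omega) (by omega),
      markov_eq_of_switch hseg hi (by omega) (by omega) (by omega) (by omega)] at he
    have e1 : κ (i + 1) - 1 + 1 + (s.val + 1) - κ (i + 1) = s.val + 1 := by omega
    have e2 : κ (i + 1) - (κ (i + 1) - 1 + 1 - 1 - t.val + 1) = t.val := by omega
    have e3 : κ (i + 1) - 1 + (s.val + 1) - κ (i + 1) = s.val := by omega
    have e4 : κ (i + 1) - (κ (i + 1) - 1 - 1 - t.val + 1) = t.val + 1 := by omega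
    rw [e1, e2, e3, e4, pow_succ, ← Matrix.mul_assoc _ _ (mode (φ (κ (i + 1)))).A,
      Matrix.mul_assoc _ (mode (φ (κ (i + 1)))).A, pow_succ', Matrix.mul_assoc (mode (φ (κ i))).A]
      at he
    exact he
  have hA := eq_of_mul_right_eq hR (eq_of_mul_left_eq hO key)
  have hne := hseg.mode_ne hi
  refine (huni (κ i) ⟨h0, hseg.le_end hi.le⟩ (κ (i + 1))
    ⟨hseg.one_le (by omega), hseg.le_end hi⟩).2 hne ?_
  rw [hA]

/-- No interval of `Z` passes the time before a switch, so each `S_i` is maximal in `Z` and not just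
in its segment. An interval with `2 * n` points is too long to fit between a steady range and a
switch, so it joins up with some `S_i`. -/
theorem maximalIntervals_iff {n m p σ : ℕ} {mode : Fin σ → DiscreteState n m p}
    {φ : ℕ → Fin σ} {N last : ℕ} {κ : ℕ → ℕ} (hn : 0 < n) (hseg : IsSegmentation φ N last κ)
    (hmin : StableMinimal mode) (huni : Unimodal mode φ N)
    (hlong : ∀ i ≤ last, LongSegment n N last κ i) {α β : ℕ → ℕ}
    (hS : ∀ i, LongSegment n N last κ i →
      IsSegmentInterval n N last κ (constantSet n N (markov mode φ)) i (α i) (β i)) (a b : ℕ) :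
    (IsMaximalInterval (constantSet n N (markov mode φ)) a b ∧ 2 * n ≤ b + 1 - a) ↔
      ∃ i ≤ last, α i = a ∧ β i = b := by
  set Z := constantSet n N (markov mode φ) with hZ
  have hbd : ∀ i ≤ last, LongBounds n N last κ i := fun i hi => (hlong i hi).bounds hn hseg
  have hlen : ∀ i ≤ last, κ i + 2 * n + 1 ≤ κ (i + 1) := by
    intro i hi
    have := (hbd i hi).length
    omega
  have hgap : ∀ i < last, κ (i + 1) - 1 ∉ Z := fun i hi =>
    switch_notMem_constantSet hseg hmin huni hi (hlen i hi.le) (hlen (i + 1) hi)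
  have hlastN : κ last + 10 * n ≤ N := by
    have h := hlong last le_rfl
    have := hseg.le_end (i := last) le_rfl
    unfold LongSegment dwell at h
    rw [if_pos rfl] at h
    omega
  have hZN : ∀ k ∈ Z, 2 * n + 1 ≤ k ∧ k ≤ N - 4 * n := fun k hk => ⟨hk.1, hk.2.1⟩
  have hmax : ∀ i ≤ last, IsMaximalInterval Z (α i) (β i) := by
    intro i hi
    have h := hS i (hlong i hi)
    refine ⟨h.le, fun x hx => (h.subset hx).1, fun a' b' ha' hb' hsub => ?_⟩
    have hle := h.le
    have hα := (h.subset (Set.left_mem_Icc.2 hle)).2.1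
    have hβ := (h.subset (Set.right_mem_Icc.2 hle)).2.2
    have hb1 : b' < κ (i + 1) := by
      rcases hi.lt_or_eq with hl | rfl
      · by_contra! hc
        exact hgap i hl (hsub ⟨by omega, by omega⟩)
      · have := (hZN _ (hsub (Set.right_mem_Icc.2 (by omega)))).2
        have := hseg.end_eq
        omega
    have ha1 : κ i ≤ a' := by
      rcases Nat.eq_zero_or_pos i with rfl | h0
      · have := (hZN _ (hsub (Set.left_mem_Icc.2 (by omega)))).1
        rw [hseg.first_eq]
        omega
      · obtain ⟨j, rfl⟩ : ∃ j, i = j + 1 := ⟨i - 1, by omega⟩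
        by_contra! hc
        exact hgap j (by omega) (hsub ⟨by omega, by omega⟩)
    have := h.maximal a' b' (ha'.trans h.left_le) (h.le_right.trans hb') fun x hx =>
      ⟨hsub hx, ha1.trans hx.1, hx.2.trans_lt hb1⟩
    rw [Set.Icc_subset_Icc_iff (by omega)] at this
    omega
  have hste : ∀ i ≤ last, α i ≤ κ i + 2 * n ∧ steadyRight n N κ i ≤ β i := fun i hi =>
    (hS i (hlong i hi)).steady_le (hbd i hi) (steady_subset hseg (hbd i hi))
  have hsr : ∀ i ≤ last, (i < last → steadyRight n N κ i = κ (i + 1) - 2 * n - 2) ∧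
      (i = last → steadyRight n N κ i = N - 4 * n) := by
    intro i hi
    constructor
    · intro h
      have := hseg.le (i := i + 1) (j := last) h (by omega)
      rw [steadyRight]
      omega
    · rintro rfl
      rw [steadyRight, hseg.end_eq]
      omega
  constructor
  · rintro ⟨⟨hab, hsub, hm⟩, hsize⟩
    have ha := hZN _ (hsub (Set.left_mem_Icc.2 hab))
    have hb := hZN _ (hsub (Set.right_mem_Icc.2 hab))
    obtain ⟨i, hi, h1, h2⟩ := hseg.exists_mem (t := a) (by omega) (by omega)
    refine ⟨i, hi, ?_⟩
    obtain ⟨h3, h4⟩ := hste i hi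
    obtain ⟨h5, h6⟩ := hsr i hi
    -- Otherwise, before a switch, `κ (i+1) - 2n ≤ a` and `b ≤ κ (i+1) - 2`, leaving at most `2n -
    -- 1` points. In the last segment the window ends at `steadyRight`.
    have h7 : a ≤ steadyRight n N κ i + 1 := by
      rcases hi.lt_or_eq with hl | hl
      · have : b < κ (i + 1) - 1 := by
          by_contra! hc
          exact hgap i hl (hsub ⟨by omega, hc⟩)
        rw [h5 hl]
        omega
      · rw [h6 hl]
        omega
    have hM := hmax i hi
    have hle := hM.1
    -- There is no hole: `a ≤ β i + 1` by `h7`, and `α i ≤ κ i + 2n ≤ b + 1` by the length of `[a,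
    -- b]`.
    have hunion : Set.Icc (min a (α i)) (max b (β i)) ⊆ Z := by
      intro x hx
      have hx1 := hx.1
      have hx2 := hx.2
      by_cases hxab : a ≤ x ∧ x ≤ b
      · exact hsub hxab
      · exact hM.2.1 ⟨by omega, by omega⟩
    have e1 := hm _ _ (min_le_left _ _) (le_max_left _ _) hunion
    have e2 := hM.2.2 _ _ (min_le_right _ _) (le_max_right _ _) hunion
    omega
  · rintro ⟨i, hi, rfl, rfl⟩
    refine ⟨hmax i hi, ?_⟩
    obtain ⟨h3, h4⟩ := hste i hi
    obtain ⟨h5, h6⟩ := hsr i hi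
    -- Before a switch the steady range has `κ (i+1) - κ i - 4n - 1` points, at least `2n` for
    -- length `6n + 1`.
    have := (hbd i hi).length
    rcases hi.lt_or_eq with hl | hl
    · have := h5 hl
      omega
    · have := h6 hl
      subst hl
      omega

/-! ### Detection of the switches -/

/-- The range includes the switch `ℓ = κ (i + 1)`, where `C` and `D` are already new but the
controllability factor is still that of segment `i`. -/
theorem exists_forward_limit {n m p σ : ℕ} {mode : Fin σ → DiscreteState n m p} {φ : ℕ → Fin σ}
    {N last : ℕ} {κ : ℕ → ℕ} (hseg : IsSegmentation φ N last κ) (hmin : StableMinimal mode)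
    {i ℓ : ℕ} (hi : i ≤ last) (h1 : κ i + 2 * n ≤ ℓ) (h2 : ℓ ≤ κ (i + 1)) (hN : ℓ ≤ N)
    {h : ℕ → ℕ → ℕ → Matrix (Fin p) (Fin m) ℝ} {E : ℕ → DiscreteState n m p}
    {Q : DiscreteState n m p} (hh : RecordTendsto (markov mode φ) N h)
    (hPQ : Similar (mode (φ (κ i))) Q) (hE : StateTendsto E Q) :
    ∃ L, Tendsto (fun k => forwardCriterion (h k) (E k) ℓ) atTop (𝓝 L) ∧ 0 ≤ L ∧
      (L = 0 ↔ (mode (φ ℓ)).C = (mode (φ (κ i))).C ∧ (mode (φ ℓ)).D = (mode (φ (κ i))).D) := by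
  have h0 := hseg.one_le (i := i) (by omega)
  refine exists_tendsto_forwardCriterion (hmin _).2 hPQ hE ?_ ?_
  · rw [← hankel_row_markov_eq hseg hi h1 h2]
    have hc : Continuous fun X : Matrix (Fin 1 × Fin p) (Fin (2 * n) × Fin m) ℝ =>
        X.submatrix (fun a => ((0 : Fin 1), a)) id := continuous_id.matrix_submatrix _ _
    exact (hc.tendsto _).comp
      (tendsto_hankel fun s _ t _ => hh _ _ (by omega) (by omega) (by omega))
  · rw [← markov_self]
    exact hh _ _ (by omega) le_rfl hN

/-- The range includes `ℓ = κ i - 1`, where `B` and `D` belong to the previous segment but the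
observability factor to segment `i`. -/
theorem exists_backward_limit {n m p σ : ℕ} {mode : Fin σ → DiscreteState n m p} {φ : ℕ → Fin σ}
    {N last : ℕ} {κ : ℕ → ℕ} (hseg : IsSegmentation φ N last κ) (hmin : StableMinimal mode)
    {i ℓ : ℕ} (hi : i ≤ last) (h1 : κ i ≤ ℓ + 1) (h2 : ℓ + 2 * n < κ (i + 1)) (h3 : 1 ≤ ℓ)
    (hN : κ (i + 1) ≤ N + 1)
    {h : ℕ → ℕ → ℕ → Matrix (Fin p) (Fin m) ℝ} {E : ℕ → DiscreteState n m p}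
    {Q : DiscreteState n m p} (hh : RecordTendsto (markov mode φ) N h)
    (hPQ : Similar (mode (φ (κ i))) Q) (hE : StateTendsto E Q) :
    ∃ L, Tendsto (fun k => backwardCriterion (h k) (E k) ℓ) atTop (𝓝 L) ∧ 0 ≤ L ∧
      (L = 0 ↔ (mode (φ ℓ)).B = (mode (φ (κ i))).B ∧ (mode (φ ℓ)).D = (mode (φ (κ i))).D) := by
  refine exists_tendsto_backwardCriterion (hmin _).2 hPQ hE ?_ ?_
  · rw [← hankel_col_markov_eq hseg hi h1 h2]
    have hc : Continuous fun X : Matrix (Fin (2 * n) × Fin p) (Fin 1 × Fin m) ℝ =>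
        X.submatrix id fun b => ((0 : Fin 1), b) := continuous_id.matrix_submatrix _ _
    exact (hc.tendsto _).comp
      (tendsto_hankel fun s _ t _ => hh _ _ (by omega) (by omega) (by omega))
  · rw [← markov_self]
    exact hh _ _ h3 le_rfl (by omega)

theorem SwitchDetectable.forward_ne {n m p σ : ℕ} {mode : Fin σ → DiscreteState n m p}
    {φ : ℕ → Fin σ} {N : ℕ} (hdet : SwitchDetectable mode φ N) {k l : ℕ} (hk : k ∈ Set.Icc 1 N)
    (hl : l ∈ Set.Icc 1 N) (hne : φ k ≠ φ l) :
    ¬ ((mode (φ k)).C = (mode (φ l)).C ∧ (mode (φ k)).D = (mode (φ l)).D) := by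
  rintro ⟨hC, hD⟩
  exact (hdet k hk l hl).1.2 hne (by rw [hC, hD])

theorem SwitchDetectable.backward_ne {n m p σ : ℕ} {mode : Fin σ → DiscreteState n m p}
    {φ : ℕ → Fin σ} {N : ℕ} (hdet : SwitchDetectable mode φ N) {k l : ℕ} (hk : k ∈ Set.Icc 1 N)
    (hl : l ∈ Set.Icc 1 N) (hne : φ k ≠ φ l) :
    ¬ ((mode (φ k)).B = (mode (φ l)).B ∧ (mode (φ k)).D = (mode (φ l)).D) := by
  rintro ⟨hB, hD⟩
  exact (hdet k hk l hl).2.2 hne (by rw [hB, hD])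

/-- The criteria are bounded below at the first time after, respectively the last time before, a long
segment. -/
theorem exists_criterion_lower_bound {n m p σ : ℕ} (hn : 0 < n)
    {mode : Fin σ → DiscreteState n m p} {φ : ℕ → Fin σ} {N last : ℕ} {κ : ℕ → ℕ}
    (hseg : IsSegmentation φ N last κ) (hmin : StableMinimal mode)
    (hdet : SwitchDetectable mode φ N) :
    ∃ τ₀, 0 < τ₀ ∧ ∀ i γ, LongBounds n N last κ i →
      IsLocallyInvariant (markov mode φ) N (mode (φ (κ i))) γ →
      ∀ h (U : ℕ → Matrix (Fin (2 * n + 1) × Fin p) (Fin n) ℝ) s V,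
        NoiseLE (markov mode φ) N τ₀ h → ConsistentSVD h U s V γ τ₀ →
      (i < last → τ₀ ≤ forwardCriterion h (realize h U s V γ) (κ (i + 1))) ∧
      (0 < i → τ₀ ≤ backwardCriterion h (realize h U s V γ) (κ i - 1)) := by
  obtain ⟨τ₀, hτ₀, hall⟩ := exists_pos_forall_mem
    (Finset.range (last + 1) ×ˢ Finset.range (N + 1))
    (fun x τ => LongBounds n N last κ x.1 →
      IsLocallyInvariant (markov mode φ) N (mode (φ (κ x.1))) x.2 →
      ∀ h (U : ℕ → Matrix (Fin (2 * n + 1) × Fin p) (Fin n) ℝ) s V,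
        NoiseLE (markov mode φ) N τ h → ConsistentSVD h U s V x.2 τ →
      (x.1 < last → τ ≤ forwardCriterion h (realize h U s V x.2) (κ (x.1 + 1))) ∧
      (0 < x.1 → τ ≤ backwardCriterion h (realize h U s V x.2) (κ x.1 - 1)))
    (fun x ε ε' hε hQ hb hγ h U s V hh hS =>
      have := hQ hb hγ h U s V (hh.mono hε) (hS.mono hε)
      ⟨fun hl => hε.trans (this.1 hl), fun hl => hε.trans (this.2 hl)⟩) (by
      rintro ⟨i, γ⟩ -
      dsimp only
      by_cases hx : LongBounds n N last κ i ∧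
        IsLocallyInvariant (markov mode φ) N (mode (φ (κ i))) γ
      swap
      · exact ⟨1, one_pos, fun h1 h2 => absurd ⟨h1, h2⟩ hx⟩
      obtain ⟨hb, hγ⟩ := hx
      have hlen := hb.length
      have hend := hb.end_le
      have hle := hb.le_last
      have hone := hb.one_le
      obtain ⟨ε, hε, hall⟩ := exists_noise_bound hn (hmin _).2 hγ
        (fun τ h P => (i < last → τ ≤ forwardCriterion h P (κ (i + 1))) ∧
          (0 < i → τ ≤ backwardCriterion h P (κ i - 1))) (by
          intro ε h E Q hε hh hPQ hE
          have hf : i < last →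
              ∀ᶠ k in atTop, ε k ≤ forwardCriterion (h k) (E k) (κ (i + 1)) := by
            intro hl
            have hN := hseg.le_end (i := i + 1) hl
            obtain ⟨L, hL, h0, hiff⟩ := exists_forward_limit hseg hmin hle
              (by omega) le_rfl hN hh hPQ hE
            have hpos : 0 < L := lt_of_le_of_ne h0 fun h0 =>
              hdet.forward_ne ⟨by omega, hN⟩ ⟨hone, by omega⟩ (hseg.mode_ne hl).symm
                (hiff.1 h0.symm)
            -- The required lower bound `ε k` tends to zero, whereas the criterion tends to `L > 0`.
            exact (hε.eventually_lt hL hpos).mono fun _ => le_of_lt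
          have hg : 0 < i →
              ∀ᶠ k in atTop, ε k ≤ backwardCriterion (h k) (E k) (κ i - 1) := by
            intro hl
            have h1 := hseg.lt hl (by omega)
            rw [hseg.first_eq] at h1
            have hne : φ (κ i - 1) ≠ φ (κ i) := by
              have := hseg.switch (i - 1) (by omega)
              rwa [Nat.sub_add_cancel hl] at this
            obtain ⟨L, hL, h0, hiff⟩ := exists_backward_limit hseg hmin (ℓ := κ i - 1) hle
              (by omega) (by omega) (by omega) hend hh hPQ hE
            have hpos : 0 < L := lt_of_le_of_ne h0 fun h0 =>
              hdet.backward_ne ⟨by omega, by omega⟩ ⟨hone, by omega⟩ hne (hiff.1 h0.symm)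
            exact (hε.eventually_lt hL hpos).mono fun _ => le_of_lt
          have hf' := eventually_imp_distrib_left.2 hf
          exact (hf'.and (eventually_imp_distrib_left.2 hg)).exists)
      exact ⟨ε, hε, fun _ _ => hall⟩)
  refine ⟨τ₀, hτ₀, fun i γ hb hγ => hall (i, γ) ?_ hb hγ⟩
  have := hb.le_last
  have := hγ.le_last
  simp only [Finset.mem_product, Finset.mem_range]
  omega

/-- Inside a long segment the criteria are small, and so is the error of the feature. -/
theorem exists_criterion_upper_bound {n m p σ : ℕ} (hn : 0 < n)
    {mode : Fin σ → DiscreteState n m p} {φ : ℕ → Fin σ} {N last : ℕ} {κ : ℕ → ℕ}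
    (hseg : IsSegmentation φ N last κ) (hmin : StableMinimal mode) {τ η : ℝ} (hτ : 0 < τ)
    (hη : 0 < η) :
    ∃ ε₀, 0 < ε₀ ∧ ∀ i γ, LongBounds n N last κ i →
      IsLocallyInvariant (markov mode φ) N (mode (φ (κ i))) γ →
      ∀ h (U : ℕ → Matrix (Fin (2 * n + 1) × Fin p) (Fin n) ℝ) s V,
        NoiseLE (markov mode φ) N ε₀ h → ConsistentSVD h U s V γ ε₀ →
      (∀ ℓ, κ i + 2 * n ≤ ℓ → ℓ < κ (i + 1) →
        forwardCriterion h (realize h U s V γ) ℓ < τ) ∧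
      (∀ ℓ, κ i ≤ ℓ → ℓ + 2 * n < κ (i + 1) →
        backwardCriterion h (realize h U s V γ) ℓ < τ) ∧
      |eigSum (realize h U s V γ).A - eigSum (mode (φ (κ i))).A| ≤ η := by
  obtain ⟨ε₀, hε₀, hall⟩ := exists_pos_forall_mem
    (Finset.range (last + 1) ×ˢ Finset.range (N + 1) ×ˢ Finset.range (N + 1))
    (fun x ε => LongBounds n N last κ x.1 →
      IsLocallyInvariant (markov mode φ) N (mode (φ (κ x.1))) x.2.1 →
      ∀ h (U : ℕ → Matrix (Fin (2 * n + 1) × Fin p) (Fin n) ℝ) s V,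
        NoiseLE (markov mode φ) N ε h → ConsistentSVD h U s V x.2.1 ε →
      (κ x.1 + 2 * n ≤ x.2.2 → x.2.2 < κ (x.1 + 1) →
        forwardCriterion h (realize h U s V x.2.1) x.2.2 < τ) ∧
      (κ x.1 ≤ x.2.2 → x.2.2 + 2 * n < κ (x.1 + 1) →
        backwardCriterion h (realize h U s V x.2.1) x.2.2 < τ) ∧
      |eigSum (realize h U s V x.2.1).A - eigSum (mode (φ (κ x.1))).A| ≤ η)
    (fun x ε ε' hε hQ hb hγ h U s V hh hS => hQ hb hγ h U s V (hh.mono hε) (hS.mono hε)) (by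
      rintro ⟨i, γ, ℓ⟩ -
      dsimp only
      by_cases hx : LongBounds n N last κ i ∧
        IsLocallyInvariant (markov mode φ) N (mode (φ (κ i))) γ
      swap
      · exact ⟨1, one_pos, fun h1 h2 => absurd ⟨h1, h2⟩ hx⟩
      obtain ⟨hb, hγ⟩ := hx
      have hend := hb.end_le
      have hle := hb.le_last
      have hone := hb.one_le
      obtain ⟨ε, hε, hall⟩ := exists_noise_bound hn (hmin _).2 hγ
        (fun _ h P => (κ i + 2 * n ≤ ℓ → ℓ < κ (i + 1) → forwardCriterion h P ℓ < τ) ∧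
          (κ i ≤ ℓ → ℓ + 2 * n < κ (i + 1) → backwardCriterion h P ℓ < τ) ∧
          |eigSum P.A - eigSum (mode (φ (κ i))).A| ≤ η) (by
          intro ε h E Q hε hh hPQ hE
          have hf : κ i + 2 * n ≤ ℓ ∧ ℓ < κ (i + 1) →
              ∀ᶠ k in atTop, forwardCriterion (h k) (E k) ℓ < τ := by
            rintro ⟨h1, h2⟩
            obtain ⟨L, hL, h0, hiff⟩ := exists_forward_limit hseg hmin hle
              h1 h2.le (by omega) hh hPQ hE
            have hc := hseg.const i hle ℓ (by omega) h2
            have hL0 : L = 0 := hiff.2 (by rw [hc]; exact ⟨rfl, rfl⟩)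
            exact hL.eventually_lt_const (hL0 ▸ hτ)
          have hg : κ i ≤ ℓ ∧ ℓ + 2 * n < κ (i + 1) →
              ∀ᶠ k in atTop, backwardCriterion (h k) (E k) ℓ < τ := by
            rintro ⟨h1, h2⟩
            obtain ⟨L, hL, h0, hiff⟩ := exists_backward_limit hseg hmin hle
              (by omega) h2 (by omega) hend hh hPQ hE
            have hc := hseg.const i hle ℓ h1 (by omega)
            have hL0 : L = 0 := hiff.2 (by rw [hc]; exact ⟨rfl, rfl⟩)
            exact hL.eventually_lt_const (hL0 ▸ hτ)
          have he : ∀ᶠ k in atTop, |eigSum (E k).A - eigSum (mode (φ (κ i))).A| ≤ η := by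
            have := ((tendsto_eigSum hE.A).sub_const (eigSum (mode (φ (κ i))).A)).abs
            rw [hPQ.eigSum_eq, sub_self, abs_zero] at this
            exact this.eventually_le_const hη
          have hf' := eventually_imp_distrib_left.2 hf
          have hg' := eventually_imp_distrib_left.2 hg
          obtain ⟨k, h1, h2, h3⟩ := (hf'.and (hg'.and he)).exists
          exact ⟨k, fun a b => h1 ⟨a, b⟩, fun a b => h2 ⟨a, b⟩, h3⟩)
      exact ⟨ε, hε, fun _ _ => hall⟩)
  refine ⟨ε₀, hε₀, fun i γ hb hγ h U s V hh hS => ?_⟩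
  have h1 := hb.le_last
  have h2 := hγ.le_last
  have h3 := hb.end_le
  have key := fun ℓ (hℓ : ℓ ≤ N) => hall (i, γ, ℓ)
    (by simp only [Finset.mem_product, Finset.mem_range]; omega) hb hγ h U s V hh hS
  -- The feature bound does not involve `ℓ`, so `ℓ = 0` serves for it.
  exact ⟨fun ℓ h4 h5 => (key ℓ (by omega)).1 h4 h5, fun ℓ h4 h5 => (key ℓ (by omega)).2.1 h4 h5,
    (key 0 (Nat.zero_le N)).2.2⟩

theorem nextSwitch_eq {n m p : ℕ} {h : ℕ → ℕ → Matrix (Fin p) (Fin m) ℝ} {P : DiscreteState n m p}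
    {N : ℕ} {τ : ℝ} {b k : ℕ} (hb : b ≤ k) (hk : k ≤ N) (h1 : τ ≤ forwardCriterion h P k)
    (h2 : ∀ ℓ, b ≤ ℓ → ℓ < k → forwardCriterion h P ℓ < τ) : nextSwitch h P N τ b = k := by
  refine IsLeast.csInf_eq ⟨⟨hb, Or.inl h1⟩, fun ℓ hℓ => ?_⟩
  by_contra! hlt
  rcases hℓ.2 with h3 | h3
  · exact absurd h3 (not_le.2 (h2 ℓ hℓ.1 hlt))
  · omega

theorem prevSwitch_eq {n m p : ℕ} {h : ℕ → ℕ → Matrix (Fin p) (Fin m) ℝ} {P : DiscreteState n m p}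
    {τ : ℝ} {a k : ℕ} (ha : k ≤ a + 1) (hk : 1 ≤ k) (h1 : τ ≤ backwardCriterion h P (k - 1))
    (h2 : ∀ ℓ, k ≤ ℓ → ℓ ≤ a → backwardCriterion h P ℓ < τ) : prevSwitch h P τ a = k := by
  have : sSup {ℓ | ℓ ≤ a ∧ (τ ≤ backwardCriterion h P ℓ ∨ ℓ = 0)} = k - 1 := by
    refine IsGreatest.csSup_eq ⟨⟨by omega, Or.inl h1⟩, fun ℓ hℓ => ?_⟩
    by_contra! hlt
    rcases hℓ.2 with h3 | h3
    · exact absurd h3 (not_le.2 (h2 ℓ (by omega) hℓ.1))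
    · omega
  rw [prevSwitch, this, Nat.sub_add_cancel hk]

/-! ### Clustering -/

/-- A link of length at most `εc` between estimates with error `εc / 2` joins true features at
distance at most `2 * εc`, below the gap, so chains never leave a discrete state. Conversely, two
estimates of one state are linked directly. -/
theorem sameCluster_iff {n m p : ℕ} {ι : Type*} {I : Set ℕ} {P : ℕ → DiscreteState n m p}
    {f : ℕ → ι} {F : ι → ℝ} {εc τ : ℝ} (hετ : εc ≤ τ)
    (herr : ∀ i ∈ I, |eigSum (P i).A - F (f i)| ≤ εc / 2)
    (hgap : ∀ i ∈ I, ∀ j ∈ I, f i ≠ f j → 2 * τ < |F (f i) - F (f j)|) {i j : ℕ} (hi : i ∈ I) :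
    SameCluster I P εc i j ↔ j ∈ I ∧ f i = f j := by
  constructor
  · intro h
    induction h with
    | refl => exact ⟨hi, rfl⟩
    | tail _ hstep ih =>
      rename_i k l _
      obtain ⟨hk, hl, hkl⟩ := hstep
      refine ⟨hl, ih.2.trans ?_⟩
      by_contra hne
      have h1 := hgap k hk l hl hne
      have h2 := abs_le.1 (herr k hk)
      have h3 := abs_le.1 (herr l hl)
      have h4 := abs_le.1 hkl
      have h5 : |F (f k) - F (f l)| ≤ 2 * εc := abs_le.2 ⟨by linarith, by linarith⟩
      linarith
  · rintro ⟨hj, hij⟩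
    refine Relation.ReflTransGen.single ⟨hi, hj, ?_⟩
    have h2 := abs_le.1 (herr i hi)
    have h3 := abs_le.1 (herr j hj)
    rw [hij] at h2
    exact abs_le.2 ⟨by linarith, by linarith⟩

/-- A set of indices for every discrete state: the indices in `I` with this state or, if there are
none, an index beyond `I` reserved for it. -/
theorem exists_injective_labels {σ : ℕ} {I : Set ℕ} {M : ℕ} (hI : ∀ i ∈ I, i ≤ M)
    (f : ℕ → Fin σ) :
    ∃ π : Fin σ → Set ℕ, Function.Injective π ∧ ∀ i ∈ I, π (f i) = {j | j ∈ I ∧ f i = f j} := by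
  classical
  refine ⟨fun c => if ∃ i ∈ I, f i = c then {j | j ∈ I ∧ c = f j} else {M + 1 + c.val}, ?_, ?_⟩
  · intro c d hcd
    dsimp only at hcd
    split_ifs at hcd with h1 h2 h2
    · obtain ⟨i, hi, rfl⟩ := h1
      have : i ∈ {j | j ∈ I ∧ d = f j} := hcd ▸ (⟨hi, rfl⟩ : i ∈ {j | j ∈ I ∧ f i = f j})
      exact this.2.symm
    · obtain ⟨i, hi, rfl⟩ := h1
      have : i ∈ ({M + 1 + d.val} : Set ℕ) :=
        hcd ▸ (⟨hi, rfl⟩ : i ∈ {j | j ∈ I ∧ f i = f j})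
      have h3 := hI i hi
      rw [Set.mem_singleton_iff] at this
      omega
    · obtain ⟨i, hi, rfl⟩ := h2
      have : i ∈ ({M + 1 + c.val} : Set ℕ) :=
        hcd ▸ (⟨hi, rfl⟩ : i ∈ {j | j ∈ I ∧ f i = f j})
      have h3 := hI i hi
      rw [Set.mem_singleton_iff] at this
      omega
    · rw [Set.singleton_eq_singleton_iff] at hcd
      exact Fin.ext (by omega)
  · intro i hi
    exact if_pos ⟨i, hi, rfl⟩

theorem exists_eigSum_gap {n m p σ : ℕ} {mode : Fin σ → DiscreteState n m p} {φ : ℕ → Fin σ}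
    {N last : ℕ} {κ : ℕ → ℕ} (hseg : IsSegmentation φ N last κ) (huni : Unimodal mode φ N) :
    ∃ τ, 0 < τ ∧ ∀ i ≤ last, ∀ j ≤ last, φ (κ i) ≠ φ (κ j) →
      2 * τ < |eigSum (mode (φ (κ i))).A - eigSum (mode (φ (κ j))).A| := by
  obtain ⟨τ, hτ, hall⟩ := exists_pos_forall_mem
    (Finset.range (last + 1) ×ˢ Finset.range (last + 1))
    (fun x τ => φ (κ x.1) ≠ φ (κ x.2) →
      2 * τ < |eigSum (mode (φ (κ x.1))).A - eigSum (mode (φ (κ x.2))).A|)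
    (fun x ε ε' hε hQ hne => lt_of_le_of_lt (by linarith) (hQ hne)) (by
      rintro ⟨i, j⟩ hx
      simp only [Finset.mem_product, Finset.mem_range] at hx
      by_cases hne : φ (κ i) = φ (κ j)
      · exact ⟨1, one_pos, fun h => absurd hne h⟩
      · have h1 := (huni (κ i) ⟨hseg.one_le (by omega), hseg.le_end (by omega)⟩ (κ j)
          ⟨hseg.one_le (by omega), hseg.le_end (by omega)⟩).2 hne
        have h2 := abs_pos.2 (sub_ne_zero.2 h1)
        -- A third of the distance works, as `2 * (d / 3) < d`.
        exact ⟨_, div_pos h2 three_pos, fun _ => by linarith⟩)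
  refine ⟨τ, hτ, fun i hi j hj => hall (i, j) ?_⟩
  simp only [Finset.mem_product, Finset.mem_range]
  omega

end SLS

theorem mainTheorem9 {n m p σ : ℕ} (hn : 0 < n)
    (mode : Fin σ → SLS.DiscreteState n m p) (φ : ℕ → Fin σ) (N last : ℕ) (κ : ℕ → ℕ)
    (hseg : SLS.IsSegmentation φ N last κ)
    (hmin : SLS.StableMinimal mode)
    (hdwell : SLS.MinDwell n N last κ)
    (huni : SLS.Unimodal mode φ N)
    (hdet : SLS.SwitchDetectable mode φ N) :
    ∃ τ₀ : ℝ, 0 < τ₀ ∧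
      ∀ εZ τ εc : ℝ, 0 < εZ → εZ ≤ τ₀ → 0 < τ → τ ≤ τ₀ → 0 < εc → εc ≤ τ₀ →
      ∃ ε₀ : ℝ, 0 < ε₀ ∧
        ∀ h : ℕ → ℕ → Matrix (Fin p) (Fin m) ℝ,
          (∀ k ℓ, 1 ≤ ℓ → ℓ ≤ k → k ≤ N → SLS.frob (h k ℓ - SLS.markov mode φ k ℓ) ≤ ε₀) →
          -- the intervals exist on all long segments
          (∀ i, SLS.LongSegment n N last κ i →
            ∃ a b, SLS.IsSegmentInterval n N last κ (SLS.quietSet n N h εZ) i a b) ∧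
          ∀ α β : ℕ → ℕ,
            (∀ i, SLS.LongSegment n N last κ i →
              SLS.IsSegmentInterval n N last κ (SLS.quietSet n N h εZ) i (α i) (β i)) →
            -- if all segments are long, they are the maximal intervals with `2n` points or more
            ((∀ i ≤ last, SLS.LongSegment n N last κ i) →
              ∀ a b, (SLS.IsMaximalInterval (SLS.quietSet n N h εZ) a b ∧ 2 * n ≤ b + 1 - a) ↔
                ∃ i ≤ last, α i = a ∧ β i = b) ∧
            -- the algorithm recovers all long segments and the switching sequence on them
            ∀ (U : ℕ → Matrix (Fin (2 * n + 1) × Fin p) (Fin n) ℝ) (s : ℕ → Fin n → ℝ)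
              (V : ℕ → Matrix (Fin (2 * n) × Fin m) (Fin n) ℝ),
              (∀ k, SLS.kFirst n ≤ k → k ≤ SLS.kLast n N + 1 →
                SLS.IsTruncatedSVD (SLS.hankel h (2 * n + 1) (2 * n) k) (U k) (s k) (V k)) →
              (∀ i, SLS.LongSegment n N last κ i →
                SLS.frob (U (SLS.midpoint (α i) (β i) + 1) - U (SLS.midpoint (α i) (β i))) ≤ ε₀) →
              ∀ (P : ℕ → SLS.DiscreteState n m p) (lo hi : ℕ → ℕ),
                (P = fun i => SLS.realize h U s V (SLS.midpoint (α i) (β i))) →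
                (lo = fun i => SLS.segLeft h (P i) τ i (α i)) →
                (hi = fun i => SLS.segRight h (P i) N last τ i (β i)) →
                (∀ i, SLS.LongSegment n N last κ i → lo i = κ i ∧ hi i = κ (i + 1)) ∧
                ∃ π : Fin σ → Set ℕ, Function.Injective π ∧
                  ∀ i, SLS.LongSegment n N last κ i → ∀ t, κ i ≤ t → t < κ (i + 1) →
                    SLS.estimatedSwitching {j | SLS.LongSegment n N last κ j} P εc lo hi t =
                      π (φ t) := by
  obtain ⟨τ₁, hτ₁, hquiet⟩ := SLS.exists_quietSet_eq n N (SLS.markov mode φ)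
  obtain ⟨τ₂, hτ₂, hlower⟩ := SLS.exists_criterion_lower_bound hn hseg hmin hdet
  obtain ⟨τ₃, hτ₃, hgap⟩ := SLS.exists_eigSum_gap hseg huni
  refine ⟨min τ₁ (min τ₂ τ₃), lt_min hτ₁ (lt_min hτ₂ hτ₃), ?_⟩
  intro εZ τ εc hεZ hεZ' hτ hτ' hεc hεc'
  obtain ⟨ε₁, hε₁, hZ⟩ := hquiet εZ hεZ (hεZ'.trans (min_le_left _ _))
  obtain ⟨ε₂, hε₂, hupper⟩ := SLS.exists_criterion_upper_bound hn hseg hmin hτ (half_pos hεc)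
  have hττ₂ : τ ≤ τ₂ := hτ'.trans ((min_le_right _ _).trans (min_le_left _ _))
  have hcτ₃ : εc ≤ τ₃ := hεc'.trans ((min_le_right _ _).trans (min_le_right _ _))
  -- `τ₂` enters because the lower bound at the switches holds for noise and SVD inconsistency up to
  -- `τ₂`.
  set ε₀ := min ε₁ (min ε₂ τ₂) with hε₀
  have hle₁ : ε₀ ≤ ε₁ := min_le_left _ _
  have hle₂ : ε₀ ≤ ε₂ := (min_le_right _ _).trans (min_le_left _ _)
  have hle₃ : ε₀ ≤ τ₂ := (min_le_right _ _).trans (min_le_right _ _)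
  refine ⟨ε₀, lt_min hε₁ (lt_min hε₂ hτ₂), fun h hh => ?_⟩
  have hN : SLS.NoiseLE (SLS.markov mode φ) N ε₀ h := hh
  -- From here on the intervals are those of the exact constant set.
  rw [hZ h (hN.mono hle₁)]
  have hbd : ∀ i, SLS.LongSegment n N last κ i → SLS.LongBounds n N last κ i :=
    fun i hi => hi.bounds hn hseg
  refine ⟨fun i hi => SLS.exists_isSegmentInterval (hbd i hi) (SLS.steady_subset hseg (hbd i hi)),
    fun α β hS => ⟨fun hlong a b =>
      SLS.maximalIntervals_iff hn hseg hmin huni hlong hS a b, ?_⟩⟩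
  intro U s V hsvd hcons P lo hi hP hlo hhi
  have hinv : ∀ i, SLS.LongSegment n N last κ i →
      SLS.IsLocallyInvariant (SLS.markov mode φ) N (mode (φ (κ i)))
        (SLS.midpoint (α i) (β i)) := by
    intro i hi
    have hle := (hS i hi).le
    exact (hS i hi).isLocallyInvariant hn hseg (hbd i hi)
      (by rw [SLS.midpoint]; omega) (by rw [SLS.midpoint]; omega)
  have hSVD : ∀ i, SLS.LongSegment n N last κ i →
      SLS.ConsistentSVD h U s V (SLS.midpoint (α i) (β i)) ε₀ := by
    intro i hi
    have h1 := (hinv i hi).first_le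
    have h2 := (hinv i hi).le_last
    exact ⟨hsvd _ (by rw [SLS.kFirst]; omega) (by rw [SLS.kLast]; omega),
      hsvd _ (by rw [SLS.kFirst]; omega) (by rw [SLS.kLast]; omega), hcons i hi⟩
  have hlow : ∀ i, SLS.LongSegment n N last κ i →
      (i < last → τ ≤ SLS.forwardCriterion h (P i) (κ (i + 1))) ∧
      (0 < i → τ ≤ SLS.backwardCriterion h (P i) (κ i - 1)) := by
    intro i hi
    have := hlower i _ (hbd i hi) (hinv i hi) h U s V (hN.mono hle₃) ((hSVD i hi).mono hle₃)
    rw [hP]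
    exact ⟨fun hl => hττ₂.trans (this.1 hl), fun hl => hττ₂.trans (this.2 hl)⟩
  have hup : ∀ i, SLS.LongSegment n N last κ i →
      (∀ ℓ, κ i + 2 * n ≤ ℓ → ℓ < κ (i + 1) → SLS.forwardCriterion h (P i) ℓ < τ) ∧
      (∀ ℓ, κ i ≤ ℓ → ℓ + 2 * n < κ (i + 1) → SLS.backwardCriterion h (P i) ℓ < τ) ∧
      |SLS.eigSum (P i).A - SLS.eigSum (mode (φ (κ i))).A| ≤ εc / 2 := by
    intro i hi
    rw [hP]
    exact hupper i _ (hbd i hi) (hinv i hi) h U s V (hN.mono hle₂) ((hSVD i hi).mono hle₂)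
  have hends : ∀ i, SLS.LongSegment n N last κ i → lo i = κ i ∧ hi i = κ (i + 1) := by
    intro i hlong
    -- The loops start at `β i ≥ κ i + 2n` and `α i ≤ κ i + 2n`; with length at least `6n + 1` they
    -- stay in the ranges where the criteria are known to be small until they reach a switch.
    obtain ⟨h1, h2⟩ := (hS i hlong).steady_le (hbd i hlong) (SLS.steady_subset hseg (hbd i hlong))
    have h3 := (hbd i hlong).left_le_right
    have h4 := (hbd i hlong).length
    have h5 := (hS i hlong).le
    have h6 := ((hS i hlong).subset (Set.left_mem_Icc.2 h5)).2.1
    have h7 := ((hS i hlong).subset (Set.right_mem_Icc.2 h5)).2.2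
    constructor
    · simp only [hlo, SLS.segLeft]
      split_ifs with h0
      · rw [h0, hseg.first_eq]
      · exact SLS.prevSwitch_eq (by omega) (hbd i hlong).one_le
          ((hlow i hlong).2 (Nat.pos_of_ne_zero h0))
          fun ℓ h8 h9 => (hup i hlong).2.1 ℓ h8 (by omega)
    · simp only [hhi, SLS.segRight]
      split_ifs with h0
      · rw [h0, hseg.end_eq]
      · have hl : i < last := lt_of_le_of_ne (hbd i hlong).le_last h0
        exact SLS.nextSwitch_eq h7.le (hseg.le_end hl) ((hlow i hlong).1 hl)
          fun ℓ h8 h9 => (hup i hlong).1 ℓ (by omega) h9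
  refine ⟨hends, ?_⟩
  obtain ⟨π, hπ, hπI⟩ := SLS.exists_injective_labels
    (I := {j | SLS.LongSegment n N last κ j}) (fun i hi => (hbd i hi).le_last) fun i => φ (κ i)
  refine ⟨π, hπ, fun i hlong t ht1 ht2 => ?_⟩
  have hcl : ∀ j, SLS.SameCluster {j | SLS.LongSegment n N last κ j} P εc i j ↔
      SLS.LongSegment n N last κ j ∧ φ (κ i) = φ (κ j) := fun j =>
    SLS.sameCluster_iff (f := fun i => φ (κ i)) (F := fun c => SLS.eigSum (mode c).A) hcτ₃
      (fun i hi => (hup i hi).2.2)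
      (fun i hi j hj => hgap i (hbd i hi).le_last j (hbd j hj).le_last) hlong
  rw [hseg.const i (hbd i hlong).le_last t ht1 ht2, hπI i hlong]
  ext j
  constructor
  · rintro ⟨k, hk, h1, h2, h3⟩
    rw [(hends k hk).1] at h1
    rw [(hends k hk).2] at h2
    -- The detected segments are the true ones, so only one of them contains `t`, and its cluster is
    -- the label.
    obtain rfl := hseg.index_unique (hbd k hk).le_last (hbd i hlong).le_last h1 h2 ht1 ht2
    exact (hcl j).1 h3
  · intro hj
    refine ⟨i, hlong, ?_, ?_, (hcl j).2 hj⟩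
    · rw [(hends i hlong).1]
      exact ht1
    · rw [(hends i hlong).2]
      exact ht2
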